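/- Let $\mathbb{D}=\{z\in\mathbb{C}:|z|\le 1\}$ be the closed unit disk, with polar coordinates $z=\rho e^{i\omega}$, Euclidean measure $dV=\rho\,d\rho\,d\omega$ and boundary defining function $x=1-\rho^2$. For $\gamma\in\mathbb{R}$ let $$\mathcal{L}_\gamma=-\rho^{-1}x^{-\gamma}\partial_\rho\big(\rho\,x^{\gamma+1}\partial_\rho\big)-\rho^{-2}\partial_\omega^2+(1+\gamma)^2=-x\Delta+(2+2\gamma)\rho\partial_\rho-\partial_\omega^2+(\gamma+1)^2,$$ acting on smooth complex-valued functions on the interior $\mathbb{D}^{int}$, and let $L^2_\gamma=L^2(\mathbb{D},x^\gamma dV)$, with inner product $(f,g)=\int_{\mathbb{D}}f\bar g\,x^\gamma dV$. Let $C^\infty(\mathbb{D})$ be the space of functions smooth on $\mathbb{D}$ up to the boundary, $x^{-\gamma}C^\infty(\mathbb{D})=\{x^{-\gamma}g: g\in C^\infty(\mathbb{D})\}$, and let $T_0$ be $\mathcal{L}_\gamma$ with domain $C_c^\infty(\mathbb{D}^{int})$, regarded as an operator in $L^2_\gamma$; it is densely defined, symmetric and nonnegative. The Friedrichs extension $\mathcal{L}_{\gamma,D}$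 of $T_0$ is defined as follows. Let $\alpha(u,v)=(T_0u,v)$ for $u,v\in D(T_0)$. A sequence $(u_n)$ in $D(T_0)$ $\alpha$-converges to $u\in L^2_\gamma$ if $u_n\to u$ in $L^2_\gamma$ and $\alpha(u_n-u_m,u_n-u_m)\to 0$ as $m,n\to\infty$. Let $V$ be the set of all such limits $u$, and extend $\alpha$ to $V$ by $\tilde\alpha(u,v)=\lim_n\alpha(u_n,v_n)$ for $u_n\to u$, $v_n\to v$ in the sense of $\alpha$-convergence. Then $u\in D(\mathcal{L}_{\gamma,D})$ and $\mathcal{L}_{\gamma,D}u=w$ if and only if $u\in V$, $w\in L^2_\gamma$ and $\tilde\alpha(u,v)=(w,v)$ for all $v\in V$. Lemma. Let $\gamma\in\mathbb{R}$. (i) If $\gamma<0$, then $\mathcal{L}_\gamma$ maps $x^{-\gamma}C^\infty(\mathbb{D})\subset L^2_\gamma$ into $L^2_\gamma$, the operator $(\mathcal{L}_\gamma,x^{-\gamma}C^\infty(\mathbb{D}))$ is essentially self-adjoint in $L^2_\gamma$, and its closure is $\mathcal{L}_{\gamma,D}$. (ii) If $\gamma\ge 0$, then $\mathcal{L}_\gamma$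 maps $C^\infty(\mathbb{D})\subset L^2_\gamma$ into $L^2_\gamma$, the operator $(\mathcal{L}_\gamma,C^\infty(\mathbb{D}))$ is essentially self-adjoint in $L^2_\gamma$, and its closure is $\mathcal{L}_{\gamma,D}$. -/

import Mathlib

open MeasureTheory Filter Topology Set
open scoped ContDiff InnerProductSpace

namespace KeldyshDisk

/-! ### The operator on functions -/

/-- The open unit disk `𝔻^int`. -/
def disk : Set ℂ := Metric.ball 0 1

/-- The boundary defining function `x = 1 - ρ²`. -/
noncomputable def bdf (z : ℂ) : ℝ := 1 - ‖z‖ ^ 2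

/-- The vector field `ρ ∂_ρ`. -/
noncomputable def radialDeriv (f : ℂ → ℂ) (z : ℂ) : ℂ := fderiv ℝ f z z

/-- The vector field `∂_ω`. -/
noncomputable def angularDeriv (f : ℂ → ℂ) (z : ℂ) : ℂ := fderiv ℝ f z (Complex.I * z)

/-- The differential operator
`L_γ = -x Δ + (2 + 2γ) ρ∂_ρ - ∂_ω² + (γ + 1)²`.
Away from the origin this is
`-ρ⁻¹ x^{-γ} ∂_ρ (ρ x^{γ+1} ∂_ρ) - ρ⁻² ∂_ω² + (1 + γ)²`: see `keldyshOp_polar`. -/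
noncomputable def keldyshOp (γ : ℝ) (f : ℂ → ℂ) (z : ℂ) : ℂ :=
  -(bdf z : ℂ) * Laplacian.laplacian f z + (2 + 2 * (γ : ℂ)) * radialDeriv f z
    - angularDeriv (angularDeriv f) z + ((γ : ℂ) + 1) ^ 2 * f z

theorem isOpen_disk : IsOpen disk := Metric.isOpen_ball

theorem bdf_pos {z : ℂ} (hz : z ∈ disk) : 0 < bdf z := by
  have h : ‖z‖ < 1 := by simpa [disk] using hz
  have h0 := norm_nonneg z
  unfold bdf
  nlinarith

theorem angularDeriv_contDiffOn {f : ℂ → ℂ} (hf : ContDiffOn ℝ ∞ f disk) :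
    ContDiffOn ℝ ∞ (angularDeriv f) disk := by
  have h1 : ContDiffOn ℝ ∞ (fderiv ℝ f) disk :=
    hf.fderiv_of_isOpen isOpen_disk (by simp)
  exact h1.clm_apply (contDiff_const.mul contDiff_id).contDiffOn

theorem keldyshOp_congr (γ : ℝ) {f g : ℂ → ℂ} (h : EqOn f g disk) :
    EqOn (keldyshOp γ f) (keldyshOp γ g) disk := by
  have key : ∀ {f g : ℂ → ℂ}, EqOn f g disk → EqOn (angularDeriv f) (angularDeriv g) disk := by
    intro f g h z hz
    have hfg : f =ᶠ[𝓝 z] g := h.eventuallyEq_of_mem (isOpen_disk.mem_nhds hz)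
    simp only [angularDeriv, hfg.fderiv_eq]
  intro z hz
  have hfg : f =ᶠ[𝓝 z] g := h.eventuallyEq_of_mem (isOpen_disk.mem_nhds hz)
  simp only [keldyshOp, radialDeriv, hfg.fderiv_eq,
    (InnerProductSpace.laplacian_congr_nhds hfg).eq_of_nhds, key (key h) hz, h hz]

theorem keldyshOp_add (γ : ℝ) {f g : ℂ → ℂ} (hf : ContDiffOn ℝ ∞ f disk)
    (hg : ContDiffOn ℝ ∞ g disk) :
    EqOn (keldyshOp γ (f + g)) (keldyshOp γ f + keldyshOp γ g) disk := by
  have key : ∀ {f g : ℂ → ℂ}, ContDiffOn ℝ ∞ f disk → ContDiffOn ℝ ∞ g disk →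
      ∀ z ∈ disk, fderiv ℝ (f + g) z = fderiv ℝ f z + fderiv ℝ g z := by
    intro f g hf hg z hz
    exact fderiv_add ((hf.contDiffAt (isOpen_disk.mem_nhds hz)).differentiableAt (by simp))
      ((hg.contDiffAt (isOpen_disk.mem_nhds hz)).differentiableAt (by simp))
  intro z hz
  have hz' := isOpen_disk.mem_nhds hz
  have h1 : angularDeriv (f + g) =ᶠ[𝓝 z] angularDeriv f + angularDeriv g := by
    filter_upwards [hz'] with w hw
    simp [angularDeriv, key hf hg w hw]
  have h2 : angularDeriv (angularDeriv (f + g)) z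
      = angularDeriv (angularDeriv f) z + angularDeriv (angularDeriv g) z := by
    rw [angularDeriv, h1.fderiv_eq,
      key (angularDeriv_contDiffOn hf) (angularDeriv_contDiffOn hg) z hz]
    rfl
  have h3 : Laplacian.laplacian (f + g) z = Laplacian.laplacian f z + Laplacian.laplacian g z :=
    ((hf.contDiffAt hz').of_le (by norm_cast)).laplacian_add
      ((hg.contDiffAt hz').of_le (by norm_cast))
  simp only [keldyshOp, radialDeriv, h2, h3, key hf hg z hz, Pi.add_apply,
    _root_.add_apply]
  ring

theorem keldyshOp_smul (γ : ℝ) (c : ℂ) {f : ℂ → ℂ} (hf : ContDiffOn ℝ ∞ f disk) :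
    EqOn (keldyshOp γ (c • f)) (c • keldyshOp γ f) disk := by
  have key : ∀ {f : ℂ → ℂ}, ContDiffOn ℝ ∞ f disk →
      ∀ z ∈ disk, fderiv ℝ (c • f) z = c • fderiv ℝ f z := by
    intro f hf z hz
    exact fderiv_const_smul ((hf.contDiffAt (isOpen_disk.mem_nhds hz)).differentiableAt (by simp)) c
  intro z hz
  have hz' := isOpen_disk.mem_nhds hz
  have h1 : angularDeriv (c • f) =ᶠ[𝓝 z] c • angularDeriv f := by
    filter_upwards [hz'] with w hw
    simp [angularDeriv, key hf w hw]
  have h2 : angularDeriv (angularDeriv (c • f)) z = c • angularDeriv (angularDeriv f) z := by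
    rw [angularDeriv, h1.fderiv_eq, key (angularDeriv_contDiffOn hf) z hz]
    rfl
  have h3 : Laplacian.laplacian (c • f) z = c • Laplacian.laplacian f z :=
    InnerProductSpace.laplacian_smul c
      ((hf.contDiffAt hz').of_le (by norm_cast))
  simp only [keldyshOp, radialDeriv, h2, h3, key hf z hz, Pi.smul_apply,
    _root_.smul_apply, smul_eq_mul]
  ring

/-- The operator in polar coordinates `z = ρ e^{iφ}`, in divergence form. -/
theorem keldyshOp_polar (γ : ℝ) {f : ℂ → ℂ} (hf : ContDiffOn ℝ ∞ f disk) {ρ : ℝ} (φ : ℝ)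
    (h0 : 0 < ρ) (h1 : ρ < 1) :
    keldyshOp γ f (ρ * Complex.exp (φ * Complex.I)) =
      -(((ρ⁻¹ * (1 - ρ ^ 2) ^ (-γ) : ℝ) : ℂ) *
          deriv (fun r : ℝ => ((r * (1 - r ^ 2) ^ (γ + 1) : ℝ) : ℂ) *
            deriv (fun r' : ℝ => f (r' * Complex.exp (φ * Complex.I))) r) ρ)
        - ((ρ : ℂ) ^ 2)⁻¹ *
          deriv (deriv fun θ : ℝ => f (ρ * Complex.exp (θ * Complex.I))) φ
        + (1 + (γ : ℂ)) ^ 2 * f (ρ * Complex.exp (φ * Complex.I)) := by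
  set e : ℂ := Complex.exp (φ * Complex.I) with he
  have hnorm : ∀ θ : ℝ, ‖Complex.exp (θ * Complex.I)‖ = 1 := Complex.norm_exp_ofReal_mul_I
  have hmem : ∀ r : ℝ, 0 < r → r < 1 → ∀ θ : ℝ, (r : ℂ) * Complex.exp (θ * Complex.I) ∈ disk := by
    intro r hr hr1 θ
    simp [disk, hnorm, abs_of_pos hr, hr1]
  have hD : ∀ {g : ℂ → ℂ}, ContDiffOn ℝ ∞ g disk → ∀ z ∈ disk, HasFDerivAt g (fderiv ℝ g z) z :=
    fun hg z hz => ((hg.contDiffAt (isOpen_disk.mem_nhds hz)).differentiableAt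
      (by simp)).hasFDerivAt
  have hray : ∀ r : ℝ, HasDerivAt (fun r : ℝ => (r : ℂ) * e) e r := by
    intro r
    simpa using (Complex.ofRealCLM.hasDerivAt (x := r)).mul_const e
  have hcirc : ∀ θ : ℝ, HasDerivAt (fun θ : ℝ => (ρ : ℂ) * Complex.exp (θ * Complex.I))
      (Complex.I * (ρ * Complex.exp (θ * Complex.I))) θ := by
    intro θ
    have h : HasDerivAt (fun θ : ℝ => (ρ : ℂ) * Complex.exp (θ * Complex.I)) _ θ :=
      ((Complex.ofRealCLM.hasDerivAt (x := θ)).mul_const Complex.I).cexp.const_mul (ρ : ℂ)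
    refine h.congr_deriv ?_
    simp only [Complex.ofRealCLM_apply, Complex.ofReal_one]
    ring
  -- angular part
  have hang : ∀ {g : ℂ → ℂ}, ContDiffOn ℝ ∞ g disk →
      (deriv fun θ : ℝ => g (ρ * Complex.exp (θ * Complex.I)))
        = fun θ : ℝ => angularDeriv g (ρ * Complex.exp (θ * Complex.I)) := by
    intro g hg
    funext θ
    exact ((hD hg _ (hmem ρ h0 h1 θ)).comp_hasDerivAt θ (hcirc θ)).deriv
  rw [hang hf, hang (angularDeriv_contDiffOn hf)]
  -- radial part
  have hf1 : ContDiffOn ℝ ∞ (fderiv ℝ f) disk := hf.fderiv_of_isOpen isOpen_disk (by simp)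
  have hz := hmem ρ h0 h1 φ
  rw [← he] at hz
  set z : ℂ := (ρ : ℂ) * e with hzdef
  set D := fderiv ℝ f z with hDdef
  set D2 := fderiv ℝ (fderiv ℝ f) z with hD2def
  have hD2 : HasFDerivAt (fderiv ℝ f) D2 z :=
    ((hf1.contDiffAt (isOpen_disk.mem_nhds hz)).differentiableAt (by simp)).hasFDerivAt
  have hrad : (fun r : ℝ => ((r * (1 - r ^ 2) ^ (γ + 1) : ℝ) : ℂ) *
      deriv (fun r' : ℝ => f (r' * e)) r) =ᶠ[𝓝 ρ]
      fun r : ℝ => ((r * (1 - r ^ 2) ^ (γ + 1) : ℝ) : ℂ) * fderiv ℝ f (r * e) e := by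
    filter_upwards [Ioo_mem_nhds h0 h1] with r hr
    have h : HasDerivAt (fun r' : ℝ => f (r' * e)) (fderiv ℝ f (r * e) e) r :=
      (hD hf _ (hmem r hr.1 hr.2 φ)).comp_hasDerivAt r (hray r)
    rw [h.deriv]
  have hx : 0 < 1 - ρ ^ 2 := by nlinarith
  have hc : HasDerivAt (fun r : ℝ => r * (1 - r ^ 2) ^ (γ + 1))
      ((1 - ρ ^ 2) ^ (γ + 1) + ρ * (-(2 * ρ) * (γ + 1) * (1 - ρ ^ 2) ^ γ)) ρ := by
    have h2 : HasDerivAt (fun r : ℝ => 1 - r ^ 2) (-(2 * ρ)) ρ := by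
      simpa using (hasDerivAt_pow 2 ρ).const_sub 1
    have h3 : HasDerivAt (fun r : ℝ => r * (1 - r ^ 2) ^ (γ + 1)) _ ρ :=
      (hasDerivAt_id ρ).mul (h2.rpow_const (p := γ + 1) (Or.inl hx.ne'))
    refine h3.congr_deriv ?_
    simp
  have hd : HasDerivAt (fun r : ℝ => fderiv ℝ f (r * e) e) (D2 e e) ρ := by
    have h4 := hD2.comp_hasDerivAt ρ (hray ρ)
    simpa using h4.clm_apply (hasDerivAt_const ρ e)
  have hprod : HasDerivAt
      (fun r : ℝ => ((r * (1 - r ^ 2) ^ (γ + 1) : ℝ) : ℂ) * fderiv ℝ f (r * e) e) _ ρ :=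
    hc.ofReal_comp.mul hd
  rw [hrad.deriv_eq, hprod.deriv]
  change _ = _ - ((ρ : ℂ) ^ 2)⁻¹ * angularDeriv (angularDeriv f) z + _
  -- second derivatives at `z`
  have hA : angularDeriv (angularDeriv f) z
      = D2 (Complex.I * z) (Complex.I * z) + D (Complex.I * (Complex.I * z)) := by
    have h5 : HasFDerivAt (fun w : ℂ => Complex.I * w)
        (Complex.I • ContinuousLinearMap.id ℝ ℂ) z := (hasFDerivAt_id z).const_mul Complex.I
    have h6 := hD2.clm_apply h5
    unfold angularDeriv
    rw [h6.fderiv]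
    simp [hDdef, add_comm]
  have hre : e = (e.re : ℝ) • (1 : ℂ) + (e.im : ℝ) • Complex.I := by
    simp [Complex.re_add_im]
  have hIe : Complex.I * e = (-e.im : ℝ) • (1 : ℂ) + (e.re : ℝ) • Complex.I := by
    apply Complex.ext <;> simp
  have hsq : ((e.re : ℂ)) ^ 2 + (e.im : ℂ) ^ 2 = 1 := by
    have h7 : ‖e‖ ^ 2 = 1 := by rw [he, hnorm]; norm_num
    rw [Complex.sq_norm, Complex.normSq_apply] at h7
    exact_mod_cast (by nlinarith : e.re ^ 2 + e.im ^ 2 = 1)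
  have hLap : Laplacian.laplacian f z = D2 e e + D2 (Complex.I * e) (Complex.I * e) := by
    rw [InnerProductSpace.laplacian_eq_iteratedFDeriv_complexPlane]
    simp only [iteratedFDeriv_two_apply, ← hD2def]
    have hquad : ∀ a b : ℝ, D2 (a • (1 : ℂ) + b • Complex.I) (a • (1 : ℂ) + b • Complex.I)
        = (a : ℂ) ^ 2 * D2 1 1 + a * b * (D2 1 Complex.I + D2 Complex.I 1)
          + (b : ℂ) ^ 2 * D2 Complex.I Complex.I := by
      intro a b
      simp only [map_add, map_smul, _root_.add_apply, _root_.smul_apply]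
      simp only [Complex.real_smul]
      ring
    have q1 := hquad e.re e.im
    have q2 := hquad (-e.im) e.re
    rw [← hre] at q1
    rw [← hIe] at q2
    rw [q1, q2]
    simp only [Matrix.cons_val_zero, Matrix.cons_val_one]
    push_cast
    linear_combination (-(D2 1 1) - D2 Complex.I Complex.I) * hsq
  have hDz : D z = ρ * D e := by
    have h8 : z = ρ • e := by simp [hzdef]
    rw [h8, map_smul, Complex.real_smul]
  have hDIz : D (Complex.I * (Complex.I * z)) = -(ρ * D e) := by
    rw [← mul_assoc, Complex.I_mul_I, neg_one_mul, map_neg, hDz]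
  have hD2z : D2 (Complex.I * z) (Complex.I * z)
      = ρ ^ 2 * D2 (Complex.I * e) (Complex.I * e) := by
    have h9 : Complex.I * z = ρ • (Complex.I * e) := by
      rw [Complex.real_smul, hzdef]; ring
    rw [h9]
    simp only [map_smul, _root_.smul_apply]
    simp only [Complex.real_smul]
    ring
  have hbdf : bdf z = 1 - ρ ^ 2 := by
    simp [bdf, hzdef, he, hnorm, abs_of_pos h0]
  have hy1 : (1 - ρ ^ 2) ^ (-γ) * (1 - ρ ^ 2) ^ (γ + 1) = 1 - ρ ^ 2 := by
    rw [← Real.rpow_add hx]; simp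
  have hy2 : (1 - ρ ^ 2) ^ (-γ) * (1 - ρ ^ 2) ^ γ = 1 := by
    rw [← Real.rpow_add hx]; simp
  set a : ℝ := (1 - ρ ^ 2) ^ (-γ)
  set b : ℝ := (1 - ρ ^ 2) ^ (γ + 1)
  set c : ℝ := (1 - ρ ^ 2) ^ γ
  have hy1' : (a : ℂ) * b = 1 - (ρ : ℂ) ^ 2 := by exact_mod_cast hy1
  have hy2' : (a : ℂ) * c = 1 := by exact_mod_cast hy2
  have hρ : (ρ : ℂ) ≠ 0 := by exact_mod_cast h0.ne'
  simp only [keldyshOp, radialDeriv, ← hDdef, hA, hLap, hDz, hDIz, hD2z, hbdf]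
  push_cast
  field_simp
  linear_combination (D e + ρ * D2 e e) * hy1' - 2 * ρ ^ 2 * (γ + 1) * D e * hy2'

/-! ### Function spaces -/

/-- Functions smooth in the open disk. -/
def smoothInterior : Submodule ℂ (ℂ → ℂ) where
  carrier := {f | ContDiffOn ℝ ∞ f disk}
  add_mem' hf hg := ContDiffOn.add hf hg
  zero_mem' := contDiffOn_const
  smul_mem' c _ hf := ContDiffOn.const_smul c hf

/-- `C_c^∞(𝔻^int)`: smooth functions with compact support in the open disk (extended by zero). -/
def testFunctions : Submodule ℂ (ℂ → ℂ) where
  carrier := {f | ContDiff ℝ ∞ f ∧ HasCompactSupport f ∧ tsupport f ⊆ disk}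
  add_mem' hf hg := ⟨hf.1.add hg.1, hf.2.1.add hg.2.1,
    (tsupport_add _ _).trans (union_subset hf.2.2 hg.2.2)⟩
  zero_mem' := ⟨contDiff_const, HasCompactSupport.zero, by simp [tsupport]⟩
  smul_mem' c f hf := ⟨hf.1.const_smul c, hf.2.1.smul_left (f := fun _ => c),
    (tsupport_smul_subset_right (fun _ => c) f).trans hf.2.2⟩

/-- `C^∞(𝔻)`: functions smooth on the closed unit disk, up to and including the boundary, i.e.
restrictions to the closed disk of smooth functions on the plane. Values outside the closed disk
are irrelevant. -/
def smoothClosed : Submodule ℂ (ℂ → ℂ) where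
  carrier := {f | ∃ g : ℂ → ℂ, ContDiff ℝ ∞ g ∧ EqOn f g (Metric.closedBall 0 1)}
  add_mem' := by
    rintro f f' ⟨g, hg, h⟩ ⟨g', hg', h'⟩
    exact ⟨g + g', hg.add hg', fun z hz => by simp [h hz, h' hz]⟩
  zero_mem' := ⟨0, contDiff_const, fun _ _ => rfl⟩
  smul_mem' := by
    rintro c f ⟨g, hg, h⟩
    exact ⟨c • g, hg.const_smul c, fun z hz => by simp [h hz]⟩

/-- `x^α C^∞(𝔻)`, as functions on the open disk. -/
def weightedSmooth (α : ℝ) : Submodule ℂ (ℂ → ℂ) where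
  carrier := {f | ∃ g ∈ smoothClosed, ∀ z ∈ disk, f z = ((bdf z ^ α : ℝ) : ℂ) * g z}
  add_mem' := by
    rintro f f' ⟨g, hg, h⟩ ⟨g', hg', h'⟩
    exact ⟨g + g', add_mem hg hg', fun z hz => by simp [h z hz, h' z hz, mul_add]⟩
  zero_mem' := ⟨0, zero_mem _, fun _ _ => by simp⟩
  smul_mem' := by
    rintro c f ⟨g, hg, h⟩
    exact ⟨c • g, Submodule.smul_mem _ c hg, fun z hz => by simp [h z hz]; ring⟩

theorem testFunctions_le : testFunctions ≤ smoothInterior := fun _ hf => hf.1.contDiffOn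

theorem smoothClosed_le : smoothClosed ≤ smoothInterior := by
  rintro f ⟨g, hg, h⟩
  exact hg.contDiffOn.congr fun z hz => h (Metric.ball_subset_closedBall hz)

theorem weightedSmooth_le (α : ℝ) : weightedSmooth α ≤ smoothInterior := by
  rintro f ⟨g, hg, h⟩
  have h1 : ContDiffOn ℝ ∞ bdf disk := (contDiff_const.sub (contDiff_norm_sq ℝ)).contDiffOn
  have h2 : ContDiffOn ℝ ∞ (fun z => bdf z ^ α) disk :=
    h1.rpow_const_of_ne fun z hz => (bdf_pos hz).ne'
  have h3 : ContDiffOn ℝ ∞ (fun z => ((bdf z ^ α : ℝ) : ℂ)) disk :=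
    Complex.ofRealCLM.contDiff.comp_contDiffOn h2
  exact (h3.mul (smoothClosed_le hg)).congr h

/-! ### The Hilbert space and realizations of the operator -/

/-- The measure `x^γ dV` on the disk (the unit circle is a null set). -/
noncomputable def diskMeasure (γ : ℝ) : Measure ℂ :=
  (volume.restrict disk).withDensity fun z => ENNReal.ofReal (bdf z ^ γ)

/-- The Hilbert space `L²_γ = L²(𝔻, x^γ dV)` of complex-valued functions. -/
abbrev L2 (γ : ℝ) : Type := Lp ℂ 2 (diskMeasure γ)

theorem ae_restrict_iff_ae_diskMeasure (γ : ℝ) {p : ℂ → Prop} :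
    (∀ᵐ z ∂(diskMeasure γ), p z) ↔ ∀ᵐ z ∂(volume.restrict disk), p z := by
  have hm : Measurable fun z => ENNReal.ofReal (bdf z ^ γ) := by
    unfold bdf
    fun_prop
  rw [diskMeasure, ae_withDensity_iff hm]
  have h : ∀ᵐ z ∂(volume.restrict disk), z ∈ disk := ae_restrict_mem isOpen_disk.measurableSet
  constructor
  · intro hp
    filter_upwards [hp, h] with z hz hd
    exact hz (by simpa using Real.rpow_pos_of_pos (bdf_pos hd) γ)
  · intro hp
    filter_upwards [hp] with z hz _ using hz

theorem ae_mem_disk (γ : ℝ) : ∀ᵐ z ∂(diskMeasure γ), z ∈ disk :=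
  (ae_restrict_iff_ae_diskMeasure γ).2 (ae_restrict_mem isOpen_disk.measurableSet)

/-- The graph of `L_γ` acting on `V`: all pairs of classes `([f], [L_γ f])` in `L²_γ × L²_γ`
with `f ∈ V`. -/
def realizationGraph (γ : ℝ) (V : Submodule ℂ (ℂ → ℂ)) (hV : V ≤ smoothInterior) :
    Submodule ℂ (L2 γ × L2 γ) where
  carrier := {p | ∃ f ∈ V, p.1 =ᵐ[diskMeasure γ] f ∧ p.2 =ᵐ[diskMeasure γ] keldyshOp γ f}
  add_mem' := by
    rintro p q ⟨f, hf, h1, h2⟩ ⟨g, hg, h3, h4⟩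
    refine ⟨f + g, add_mem hf hg, (Lp.coeFn_add _ _).trans (h1.add h3), ?_⟩
    filter_upwards [Lp.coeFn_add p.2 q.2, h2, h4, ae_mem_disk γ] with z e1 e2 e3 hz
    rw [keldyshOp_add γ (hV hf) (hV hg) hz, Prod.snd_add, e1, Pi.add_apply, Pi.add_apply, e2, e3]
  zero_mem' := by
    refine ⟨0, zero_mem _, Lp.coeFn_zero _ _ _, ?_⟩
    filter_upwards [Lp.coeFn_zero ℂ 2 (diskMeasure γ), ae_mem_disk γ] with z e1 hz
    have := keldyshOp_smul γ 0 (hV V.zero_mem) hz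
    simp only [smul_zero, zero_smul, Pi.zero_apply] at this
    rw [this, Prod.snd_zero, e1, Pi.zero_apply]
  smul_mem' := by
    rintro c p ⟨f, hf, h1, h2⟩
    refine ⟨c • f, Submodule.smul_mem _ c hf, (Lp.coeFn_smul _ _).trans (h1.const_smul c), ?_⟩
    filter_upwards [Lp.coeFn_smul c p.2, h2, ae_mem_disk γ] with z e1 e2 hz
    rw [keldyshOp_smul γ c (hV hf) hz, Prod.smul_snd, e1, Pi.smul_apply, Pi.smul_apply, e2]

theorem realizationGraph_functional (γ : ℝ) (V : Submodule ℂ (ℂ → ℂ)) (hV : V ≤ smoothInterior)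
    (p : L2 γ × L2 γ) (hp : p ∈ realizationGraph γ V hV) (h0 : p.1 = 0) : p.2 = 0 := by
  obtain ⟨f, hf, h1, h2⟩ := hp
  have h3 : f =ᵐ[diskMeasure γ] (0 : ℂ → ℂ) := by
    rw [h0] at h1
    exact h1.symm.trans (Lp.coeFn_zero _ _ _)
  have h4 : EqOn f 0 disk :=
    Measure.eqOn_open_of_ae_eq ((ae_restrict_iff_ae_diskMeasure γ).1 h3) isOpen_disk
      (hV hf).continuousOn continuousOn_const
  have h5 : EqOn (keldyshOp γ f) 0 disk := by
    intro z hz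
    have := keldyshOp_smul γ 0 (hV hf) hz
    rw [keldyshOp_congr γ h4 hz]
    simpa using this
  refine Lp.ext ?_
  filter_upwards [h2, Lp.coeFn_zero ℂ 2 (diskMeasure γ), ae_mem_disk γ] with z e1 e2 hz
  rw [e1, e2, h5 hz]

/-- The operator `(L_γ, V)`, acting in `L²_γ`. -/
noncomputable def realization (γ : ℝ) (V : Submodule ℂ (ℂ → ℂ)) (hV : V ≤ smoothInterior) :
    L2 γ →ₗ.[ℂ] L2 γ :=
  (realizationGraph γ V hV).toLinearPMap

theorem realization_graph (γ : ℝ) (V : Submodule ℂ (ℂ → ℂ)) (hV : V ≤ smoothInterior) :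
    (realization γ V hV).graph = realizationGraph γ V hV :=
  Submodule.toLinearPMap_graph_eq _ (realizationGraph_functional γ V hV)

/-! ### Friedrichs extensions -/

section Friedrichs

variable {H : Type*} [NormedAddCommGroup H] [InnerProductSpace ℂ H]

/-- The form `α(u, v) = (T u, v)` on the domain of `T`, linear in `u` and antilinear in `v`. -/
noncomputable def assocForm (T : H →ₗ.[ℂ] H) (u v : T.domain) : ℂ := ⟪(v : H), T u⟫_ℂ

/-- The sequence `s` in the domain of `T` `α`-converges to `u ∈ H`: it converges to `u` in `H` and
is Cauchy for the form `α`. -/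
def AlphaTendsto (T : H →ₗ.[ℂ] H) (s : ℕ → T.domain) (u : H) : Prop :=
  Tendsto (fun n => (s n : H)) atTop (𝓝 u) ∧
    Tendsto (fun p : ℕ × ℕ => assocForm T (s p.1 - s p.2) (s p.1 - s p.2)) atTop (𝓝 0)

/-- `F` is the Friedrichs extension of the densely defined, symmetric, nonnegative operator `T`.
The form domain, that is the completion of the domain of `T` for the form norm seen inside `H`,
consists of the limits of `α`-convergent sequences, and the extended form is
`α̃(u, v) = lim α(s n, t n)` along sequences `α`-converging to `u` and `v`. The graph of `F` is the
set of the pairs `(u, w)` such that `u` is in the form domain and `α̃(u, v) = (w, v)` for every `v`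
in the form domain; that is, `α̃(u, ·)` is bounded for the norm of `H` and represented by `w`. -/
structure IsFriedrichsExtension (T F : H →ₗ.[ℂ] H) : Prop where
  dense : Dense (T.domain : Set H)
  symmetric : T.IsFormalAdjoint T
  nonneg : ∀ u : T.domain, 0 ≤ (assocForm T u u).re
  graph_iff : ∀ u w : H, (u, w) ∈ F.graph ↔
    ∃ s : ℕ → T.domain, AlphaTendsto T s u ∧
      ∀ (v : H) (t : ℕ → T.domain), AlphaTendsto T t v →
        Tendsto (fun n => assocForm T (s n) (t n)) atTop (𝓝 ⟪v, w⟫_ℂ)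

theorem IsFriedrichsExtension.unique {T F G : H →ₗ.[ℂ] H} (hF : IsFriedrichsExtension T F)
    (hG : IsFriedrichsExtension T G) : F = G :=
  LinearPMap.eq_of_eq_graph (by ext ⟨u, w⟩; rw [hF.graph_iff, hG.graph_iff])

/-- A densely defined symmetric operator is essentially self-adjoint if its closure is
self-adjoint. -/
structure IsEssentiallySelfAdjoint [CompleteSpace H] (T : H →ₗ.[ℂ] H) : Prop where
  dense : Dense (T.domain : Set H)
  symmetric : T.IsFormalAdjoint T
  closure_selfAdjoint : IsSelfAdjoint T.closure

end Friedrichs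

end KeldyshDisk

namespace KeldyshDisk

/-! ### Essential self-adjointness and Friedrichs extensions in Hilbert space -/

section HilbertSpace

variable {H : Type*} [NormedAddCommGroup H] [InnerProductSpace ℂ H]

/-! The case `γ < 0` reduces to the opposite exponent. Multiplication by `x^{-γ}` is an isometry
from `L²_{-γ}` to `L²_γ`, preserves test functions, and intertwines `L_{-γ}` with `L_γ`
(`keldyshOp_bdfPow_mul`, `eLpNorm_bdfPow_mul`). All properties needed of `C^∞(𝔻)` at `-γ > 0`
therefore transfer to `x^{-γ} C^∞(𝔻)` at `γ`.

For `γ ≥ 0` the measure is finite. On `C^∞(𝔻)` the operator is symmetric and nonnegative, since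
integration by parts leaves no boundary term (`integral_keldyshOp_mul`) and the form is the integral
of a nonnegative energy density. A nonnegative symmetric `T` for which `T + 1` has dense range is
essentially self-adjoint: its closure equals its adjoint (`mem_closure_graph_iff`). The range is
dense because `L_γ + 1` is triangular with nonzero diagonal on the monomials `z^a z̄^b`
(`keldyshOp_monomial`), hence maps polynomials in `z, z̄` onto themselves, and these are dense by
Stone–Weierstrass.

To identify the closure with the Friedrichs extension it suffices that test functions are dense in
`C^∞(𝔻)` for the form norm (`isFriedrichsExtension_closure`). Multiply by cutoffs that vary in `log
x` between `-2N` and `-N`. Their gradients contribute at most a constant times `N^{-2} ∫ 1/x` over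
`x ≥ e^{-2N}`, which is `O(1/N)` (`integral_truncInv`). The logarithmic scale is needed at `γ = 0`:
a cutoff between `x = ε` and `x = 2ε` has energy of order one. The boundary circle thus has zero
capacity for the form. -/

theorem assocForm_sub_left (T : H →ₗ.[ℂ] H) (u v w : T.domain) :
    assocForm T (u - v) w = assocForm T u w - assocForm T v w := by
  simp [assocForm, T.map_sub]

theorem conj_assocForm {T : H →ₗ.[ℂ] H} (hs : T.IsFormalAdjoint T) (u v : T.domain) :
    starRingEnd ℂ (assocForm T u v) = assocForm T v u := by
  simp only [assocForm, inner_conj_symm]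
  exact hs u v

theorem assocForm_self_im {T : H →ₗ.[ℂ] H} (hs : T.IsFormalAdjoint T) (u : T.domain) :
    (assocForm T u u).im = 0 :=
  Complex.conj_eq_iff_im.1 (conj_assocForm hs u u)

/-- The form of a symmetric nonnegative operator as a semi-inner product. -/
@[reducible]
noncomputable def formCore {T : H →ₗ.[ℂ] H} (hs : T.IsFormalAdjoint T)
    (hn : ∀ u : T.domain, 0 ≤ (assocForm T u u).re) : PreInnerProductSpace.Core ℂ T.domain where
  inner u v := assocForm T v u
  conj_inner_symm u v := conj_assocForm hs u v
  re_inner_nonneg u := hn u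
  add_left u v w := by simp [assocForm]
  smul_left u v c := by simp [assocForm, mul_comm]

/-- Cauchy–Schwarz, which needs only semidefiniteness of the form. -/
theorem norm_assocForm_sq_le {T : H →ₗ.[ℂ] H} (hs : T.IsFormalAdjoint T)
    (hn : ∀ u : T.domain, 0 ≤ (assocForm T u u).re) (u v : T.domain) :
    ‖assocForm T u v‖ ^ 2 ≤ (assocForm T u u).re * (assocForm T v v).re := by
  have h := @InnerProductSpace.Core.inner_mul_inner_self_le ℂ T.domain _ _ _ (formCore hs hn) v u
  have e : ‖assocForm T v u‖ = ‖assocForm T u v‖ := by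
    rw [← conj_assocForm hs u v, RCLike.norm_conj]
  change ‖assocForm T u v‖ * ‖assocForm T v u‖ ≤ (assocForm T v v).re * (assocForm T u u).re at h
  rw [e] at h
  rw [sq, mul_comm (assocForm T u u).re]
  exact h

/-- The parallelogram law with the nonnegative term at `u + v` dropped; it stands in for the
triangle inequality throughout. -/
theorem assocForm_sub_self_re_le {T : H →ₗ.[ℂ] H} (hn : ∀ u : T.domain, 0 ≤ (assocForm T u u).re)
    (u v : T.domain) :
    (assocForm T (u - v) (u - v)).re ≤
      2 * (assocForm T u u).re + 2 * (assocForm T v v).re := by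
  have h := hn (u + v)
  have e : (assocForm T (u - v) (u - v)).re + (assocForm T (u + v) (u + v)).re =
      2 * (assocForm T u u).re + 2 * (assocForm T v v).re := by
    simp only [assocForm, T.map_sub, T.map_add, Submodule.coe_sub, Submodule.coe_add,
      inner_sub_left, inner_sub_right, inner_add_left, inner_add_right, Complex.sub_re,
      Complex.add_re]
    ring
  linarith

theorem norm_assocForm_self {T : H →ₗ.[ℂ] H} (hs : T.IsFormalAdjoint T)
    (hn : ∀ u : T.domain, 0 ≤ (assocForm T u u).re) (u : T.domain) :
    ‖assocForm T u u‖ = (assocForm T u u).re := by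
  rw [← Complex.abs_re_eq_norm.2 (assocForm_self_im hs u), abs_of_nonneg (hn u)]

theorem AlphaTendsto.exists_bound {T : H →ₗ.[ℂ] H} (hs : T.IsFormalAdjoint T)
    (hn : ∀ u : T.domain, 0 ≤ (assocForm T u u).re) {s : ℕ → T.domain} {u : H}
    (h : AlphaTendsto T s u) : ∃ C, ∀ᶠ n in atTop, (assocForm T (s n) (s n)).re ≤ C := by
  have h1 := (h.2.norm.eventually_lt_const (by simp : ‖(0 : ℂ)‖ < 1))
  rw [← prod_atTop_atTop_eq] at h1
  obtain ⟨p, hp, q, hq, hpq⟩ := Filter.eventually_prod_iff.1 h1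
  obtain ⟨m, hm⟩ := hq.exists
  -- Comparison with the fixed index `m` gives the bound `2 + 2 α(s m, s m)`; the larger constant is
  -- harmless because `α` is nonnegative.
  refine ⟨2 * 1 + 2 * (2 * (assocForm T (s m) (s m)).re) + 2 * (assocForm T (s m) (s m)).re, ?_⟩
  filter_upwards [hp] with n hnp
  have h2 := hpq hnp hm
  rw [norm_assocForm_self hs hn] at h2
  have h3 := assocForm_sub_self_re_le hn (s n - s m) (- s m)
  have h4 : (assocForm T (-s m) (-s m)).re = (assocForm T (s m) (s m)).re := by
    simp [assocForm, T.map_neg]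
  rw [sub_neg_eq_add, sub_add_cancel, h4] at h3
  have := hn (s m)
  linarith

/-- A sequence along which `(T + 1) v n` converges converges in the graph norm. -/
theorem exists_tendsto_of_tendsto_add [CompleteSpace H] {T : H →ₗ.[ℂ] H}
    (hn : ∀ u : T.domain, 0 ≤ (assocForm T u u).re) {v : ℕ → T.domain} {h : H}
    (hv : Tendsto (fun n => T (v n) + (v n : H)) atTop (𝓝 h)) :
    ∃ u : H, Tendsto (fun n => (v n : H)) atTop (𝓝 u) := by
  -- Nonnegativity gives `‖x‖² ≤ Re (x, (T + 1) x)`, so `T + 1` is bounded below by `1`.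
  have key : ∀ x : T.domain, ‖(x : H)‖ ≤ ‖T x + (x : H)‖ := by
    intro x
    have h1 : ‖(x : H)‖ ^ 2 ≤ (⟪(x : H), T x + x⟫_ℂ).re := by
      have h2 := hn x
      have h3 := inner_self_eq_norm_sq (𝕜 := ℂ) (x : H)
      rw [RCLike.re_eq_complex_re] at h3
      rw [inner_add_right, Complex.add_re, h3]
      simpa [assocForm] using h2
    have h4 : (⟪(x : H), T x + x⟫_ℂ).re ≤ ‖(x : H)‖ * ‖T x + (x : H)‖ :=
      (Complex.re_le_norm _).trans (norm_inner_le_norm _ _)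
    rcases (norm_nonneg (x : H)).eq_or_lt with h0 | h0
    · rw [← h0]; exact norm_nonneg _
    · exact le_of_mul_le_mul_left (by nlinarith) h0
  apply cauchySeq_tendsto_of_complete
  have hc := hv.cauchySeq
  rw [Metric.cauchySeq_iff] at hc ⊢
  intro ε hε
  obtain ⟨N, hN⟩ := hc ε hε
  refine ⟨N, fun m hm n hn' => lt_of_le_of_lt ?_ (hN m hm n hn')⟩
  rw [dist_eq_norm, dist_eq_norm]
  have := key (v m - v n)
  rw [T.map_sub] at this
  have e : T (v m) + (v m : H) - (T (v n) + (v n : H)) =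
      T (v m) - T (v n) + ((v m - v n : T.domain) : H) := by
    rw [Submodule.coe_sub]; abel
  rw [e]
  exact this

/-- For a nonnegative symmetric operator `T` such that `T + 1` has dense range, every pair in the
graph of the adjoint is a limit of pairs in the graph of `T`. -/
theorem exists_graph_tendsto [CompleteSpace H] {T : H →ₗ.[ℂ] H} (hs : T.IsFormalAdjoint T)
    (hn : ∀ u : T.domain, 0 ≤ (assocForm T u u).re)
    (hr : DenseRange fun u : T.domain => T u + (u : H)) {u w : H}
    (huw : ∀ y : T.domain, ⟪(y : H), w⟫_ℂ = ⟪T y, u⟫_ℂ) :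
    ∃ v : ℕ → T.domain, Tendsto (fun n => (v n : H)) atTop (𝓝 u) ∧
      Tendsto (fun n => T (v n)) atTop (𝓝 w) := by
  have hmem : w + u ∈ closure (range fun u : T.domain => T u + (u : H)) := hr _
  obtain ⟨x, hx, hxl⟩ := mem_closure_iff_seq_limit.1 hmem
  choose v hv using hx
  obtain rfl : (fun n => T (v n) + (v n : H)) = x := funext hv
  obtain ⟨u', hu'⟩ := exists_tendsto_of_tendsto_add hn hxl
  -- Both `u` and the limit `u'` pair with `(T + 1) y` to give `(y, w + u)`; dense range of `T + 1`
  -- forces them to agree.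
  have huu : u = u' := by
    refine hr.eq_of_inner_right ℂ fun y => ?_
    have h1 : Tendsto (fun n => ⟪T y + (y : H), (v n : H)⟫_ℂ) atTop (𝓝 ⟪T y + (y : H), u'⟫_ℂ) :=
      tendsto_const_nhds.inner hu'
    have h2 : Tendsto (fun n => ⟪(y : H), T (v n) + (v n : H)⟫_ℂ) atTop (𝓝 ⟪(y : H), w + u⟫_ℂ) :=
      tendsto_const_nhds.inner hxl
    have h3 : ∀ n, ⟪(y : H), T (v n) + (v n : H)⟫_ℂ = ⟪T y + (y : H), (v n : H)⟫_ℂ := fun n => by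
      rw [inner_add_right, inner_add_left, hs y (v n)]
    simp only [h3] at h2
    rw [tendsto_nhds_unique h1 h2, inner_add_left, inner_add_right, huw y]
  subst huu
  refine ⟨v, hu', ?_⟩
  simpa using hxl.sub hu'

/-- A symmetric operator is a restriction of its adjoint, which is closed. -/
theorem isClosable_of_symmetric [CompleteSpace H] {T : H →ₗ.[ℂ] H} (hd : Dense (T.domain : Set H))
    (hs : T.IsFormalAdjoint T) : T.IsClosable :=
  (LinearPMap.adjoint_isClosed hd).isClosable.leIsClosable (hs.le_adjoint hd)

theorem exists_seq_of_mem_closure_graph {T : H →ₗ.[ℂ] H} (hc : T.IsClosable) {u w : H}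
    (h : (u, w) ∈ T.closure.graph) :
    ∃ v : ℕ → T.domain, Tendsto (fun n => (v n : H)) atTop (𝓝 u) ∧
      Tendsto (fun n => T (v n)) atTop (𝓝 w) := by
  rw [← hc.graph_closure_eq_closure_graph] at h
  obtain ⟨x, hx, hxl⟩ := mem_closure_iff_seq_limit.1 (show (u, w) ∈ closure (T.graph : Set (H × H))
    from h)
  choose v hv1 hv2 using fun n => (LinearPMap.mem_graph_iff T).1 (hx n)
  have h1 := (continuous_fst.tendsto _).comp hxl
  have h2 := (continuous_snd.tendsto _).comp hxl
  refine ⟨v, h1.congr fun n => (hv1 n).symm, h2.congr fun n => (hv2 n).symm⟩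

theorem mem_closure_graph_of_seq {T : H →ₗ.[ℂ] H} (hc : T.IsClosable) {u w : H}
    {v : ℕ → T.domain} (h1 : Tendsto (fun n => (v n : H)) atTop (𝓝 u))
    (h2 : Tendsto (fun n => T (v n)) atTop (𝓝 w)) : (u, w) ∈ T.closure.graph := by
  rw [← hc.graph_closure_eq_closure_graph]
  exact mem_closure_of_tendsto (h1.prodMk_nhds h2)
    (Eventually.of_forall fun n => T.mem_graph (v n))

/-- The right-hand side is the graph of the adjoint, so this says that the closure equals the
adjoint. Symmetry gives one inclusion; dense range of `T + 1` gives the other through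
`exists_graph_tendsto`. -/
theorem mem_closure_graph_iff [CompleteSpace H] {T : H →ₗ.[ℂ] H} (hd : Dense (T.domain : Set H))
    (hs : T.IsFormalAdjoint T) (hn : ∀ u : T.domain, 0 ≤ (assocForm T u u).re)
    (hr : DenseRange fun u : T.domain => T u + (u : H)) (u w : H) :
    (u, w) ∈ T.closure.graph ↔ ∀ y : T.domain, ⟪(y : H), w⟫_ℂ = ⟪T y, u⟫_ℂ := by
  have hc := isClosable_of_symmetric hd hs
  constructor
  · intro h y
    obtain ⟨v, h1, h2⟩ := exists_seq_of_mem_closure_graph hc h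
    refine tendsto_nhds_unique (tendsto_const_nhds.inner h2) ?_
    simp only [← hs y _]
    exact tendsto_const_nhds.inner h1
  · intro h
    obtain ⟨v, h1, h2⟩ := exists_graph_tendsto hs hn hr h
    exact mem_closure_graph_of_seq hc h1 h2

/-- An operator and its closure have the same adjoint, and the adjoint of `T` is already known to be
its closure. -/
theorem isEssentiallySelfAdjoint_of_denseRange [CompleteSpace H] {T : H →ₗ.[ℂ] H} (hd : Dense (T.domain : Set H))
    (hs : T.IsFormalAdjoint T) (hn : ∀ u : T.domain, 0 ≤ (assocForm T u u).re)
    (hr : DenseRange fun u : T.domain => T u + (u : H)) : IsEssentiallySelfAdjoint T := by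
  refine ⟨hd, hs, ?_⟩
  have hd' : Dense (T.closure.domain : Set H) := hd.mono T.le_closure.1
  rw [LinearPMap.isSelfAdjoint_def]
  refine LinearPMap.eq_of_eq_graph ?_
  rw [LinearPMap.adjoint_graph_eq_graph_adjoint hd']
  ext ⟨u, w⟩
  rw [Submodule.mem_adjoint_iff]
  constructor
  · intro h
    refine (mem_closure_graph_iff hd hs hn hr u w).2 fun y => (sub_eq_zero.1 (h y (T y) ?_)).symm
    exact LinearPMap.le_graph_of_le T.le_closure (T.mem_graph y)
  · intro h a b hab
    rw [sub_eq_zero]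
    obtain ⟨v, h1, h2⟩ := exists_seq_of_mem_closure_graph (isClosable_of_symmetric hd hs) hab
    refine tendsto_nhds_unique (h2.inner tendsto_const_nhds) ?_
    simp only [← (mem_closure_graph_iff hd hs hn hr u w).1 h _]
    exact h1.inner tendsto_const_nhds

/-! ### Friedrichs extension of a restriction -/

theorem assocForm_inclusion {S T : H →ₗ.[ℂ] H} (hST : S ≤ T) (u v : S.domain) :
    assocForm T (Submodule.inclusion hST.1 u) (Submodule.inclusion hST.1 v) = assocForm S u v := by
  have h : S u = T (Submodule.inclusion hST.1 u) := hST.2 rfl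
  simp [assocForm, h]

theorem isFormalAdjoint_of_le {S T : H →ₗ.[ℂ] H} (hST : S ≤ T) (hs : T.IsFormalAdjoint T) :
    S.IsFormalAdjoint S := fun x y => by
  rw [show S x = T (Submodule.inclusion hST.1 x) from hST.2 rfl,
    show S y = T (Submodule.inclusion hST.1 y) from hST.2 rfl]
  exact hs (Submodule.inclusion hST.1 x) (Submodule.inclusion hST.1 y)

theorem norm_assocForm_sub_self_le {T : H →ₗ.[ℂ] H} (hs : T.IsFormalAdjoint T)
    (hn : ∀ u : T.domain, 0 ≤ (assocForm T u u).re) (u v : T.domain) :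
    ‖assocForm T (u - v) (u - v)‖ ≤
      2 * (assocForm T u u).re + 2 * (assocForm T v v).re := by
  rw [norm_assocForm_self hs hn]
  exact assocForm_sub_self_re_le hn u v

/-- A sequence that is close, in the form sense, to one converging in the graph norm `α`-converges,
and its form against `α`-convergent sequences converges. -/
theorem alphaTendsto_of_graph_tendsto {S T : H →ₗ.[ℂ] H} (hST : S ≤ T) (hs : T.IsFormalAdjoint T)
    (hn : ∀ u : T.domain, 0 ≤ (assocForm T u u).re) {v : ℕ → T.domain} {s : ℕ → S.domain} {u w : H}
    (h1 : Tendsto (fun n => (v n : H)) atTop (𝓝 u)) (h2 : Tendsto (fun n => T (v n)) atTop (𝓝 w))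
    (h3 : Tendsto (fun n => (v n : H) - s n) atTop (𝓝 0))
    (h4 : Tendsto (fun n => (assocForm T (v n - Submodule.inclusion hST.1 (s n))
      (v n - Submodule.inclusion hST.1 (s n))).re) atTop (𝓝 0)) :
    AlphaTendsto S s u ∧ ∀ (y : H) (t : ℕ → S.domain), AlphaTendsto S t y →
        Tendsto (fun n => assocForm S (s n) (t n)) atTop (𝓝 ⟪y, w⟫_ℂ) := by
  set ι := Submodule.inclusion hST.1 with hι
  have hsS := isFormalAdjoint_of_le hST hs
  have hnS : ∀ u : S.domain, 0 ≤ (assocForm S u u).re := fun u => by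
    rw [← assocForm_inclusion hST]; exact hn _
  refine ⟨⟨?_, ?_⟩, ?_⟩
  · simpa using h1.sub h3
  · have hv : Tendsto (fun p : ℕ × ℕ => (assocForm T (v p.1 - v p.2) (v p.1 - v p.2)).re) atTop
        (𝓝 0) := by
      have e1 : Tendsto (fun p : ℕ × ℕ => (v p.1 : H) - v p.2) atTop (𝓝 (u - u)) := by
        rw [← prod_atTop_atTop_eq]
        exact (h1.comp tendsto_fst).sub (h1.comp tendsto_snd)
      have e2 : Tendsto (fun p : ℕ × ℕ => T (v p.1) - T (v p.2)) atTop (𝓝 (w - w)) := by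
        rw [← prod_atTop_atTop_eq]
        exact (h2.comp tendsto_fst).sub (h2.comp tendsto_snd)
      have e3 := (Complex.continuous_re.tendsto _).comp (e1.inner (𝕜 := ℂ) e2)
      simp only [sub_self, inner_zero_left, Complex.zero_re] at e3
      simp only [assocForm, T.map_sub, Submodule.coe_sub]
      exact e3
    have hd : Tendsto (fun p : ℕ × ℕ => 2 * (2 * (assocForm T (v p.1 - ι (s p.1))
          (v p.1 - ι (s p.1))).re + 2 * (assocForm T (v p.2 - ι (s p.2))
          (v p.2 - ι (s p.2))).re)) atTop (𝓝 (2 * (2 * 0 + 2 * 0))) := by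
      rw [← prod_atTop_atTop_eq]
      exact (((h4.comp tendsto_fst).const_mul 2).add ((h4.comp tendsto_snd).const_mul 2)).const_mul 2
    refine squeeze_zero_norm (fun p => ?_) (by simpa using (hv.const_mul 2).add hd)
    rw [← assocForm_inclusion hST, ← hι]
    -- The sequence `v` is Cauchy for the form because it converges in the graph norm, and the
    -- errors `v - s` tend to zero in the form.
    have e : ι (s p.1 - s p.2) =
        (v p.1 - v p.2) - ((v p.1 - ι (s p.1)) - (v p.2 - ι (s p.2))) := by
      rw [map_sub]; abel
    rw [e]
    refine (norm_assocForm_sub_self_le hs hn _ _).trans ?_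
    have := assocForm_sub_self_re_le hn (v p.1 - ι (s p.1)) (v p.2 - ι (s p.2))
    linarith
  · intro y t ht
    obtain ⟨C, hC⟩ := ht.exists_bound hsS hnS
    have e1 : Tendsto (fun n => assocForm T (v n) (ι (t n))) atTop (𝓝 ⟪y, w⟫_ℂ) := by
      simpa [assocForm, hι] using ht.1.inner (𝕜 := ℂ) h2
    -- By Cauchy–Schwarz: the error tends to zero in the form, while `t` stays bounded in it.
    have e2 : Tendsto (fun n => assocForm T (v n - ι (s n)) (ι (t n))) atTop (𝓝 0) := by
      have e3 : Tendsto (fun n => √((assocForm T (v n - ι (s n)) (v n - ι (s n))).re * C)) atTop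
          (𝓝 0) := by
        simpa using (h4.mul_const C).sqrt
      refine squeeze_zero_norm' ?_ e3
      filter_upwards [hC] with n hCn
      refine Real.le_sqrt_of_sq_le ((norm_assocForm_sq_le hs hn _ _).trans ?_)
      rw [assocForm_inclusion hST]
      exact mul_le_mul_of_nonneg_left hCn (hn _)
    refine (by simpa using e1.sub e2 : Tendsto _ atTop (𝓝 ⟪y, w⟫_ℂ)).congr fun n => ?_
    rw [← assocForm_inclusion hST, ← hι, assocForm_sub_left]
    ring

/-- The closure of `T` is the Friedrichs extension of its restriction `S`, if the domain of `S` is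
dense in that of `T` for the form norm. -/
theorem isFriedrichsExtension_closure [CompleteSpace H] {S T : H →ₗ.[ℂ] H} (hST : S ≤ T)
    (hd : Dense (S.domain : Set H)) (hs : T.IsFormalAdjoint T)
    (hn : ∀ u : T.domain, 0 ≤ (assocForm T u u).re)
    (hr : DenseRange fun u : T.domain => T u + (u : H))
    (happ : ∀ u : T.domain, ∀ ε > 0, ∃ s : S.domain, ‖(u : H) - s‖ < ε ∧
      (assocForm T (u - Submodule.inclusion hST.1 s) (u - Submodule.inclusion hST.1 s)).re < ε) :
    IsFriedrichsExtension S T.closure := by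
  have hsS := isFormalAdjoint_of_le hST hs
  have key : ∀ {u w : H} (v : ℕ → T.domain), Tendsto (fun n => (v n : H)) atTop (𝓝 u) →
      Tendsto (fun n => T (v n)) atTop (𝓝 w) → ∃ s : ℕ → S.domain, AlphaTendsto S s u ∧
      ∀ (y : H) (t : ℕ → S.domain), AlphaTendsto S t y →
        Tendsto (fun n => assocForm S (s n) (t n)) atTop (𝓝 ⟪y, w⟫_ℂ) := by
    intro u w v h1 h2
    choose s hs1 hs2 using fun n => happ (v n) (1 / ((n : ℝ) + 1)) (by positivity)
    refine ⟨s, alphaTendsto_of_graph_tendsto hST hs hn h1 h2 ?_ ?_⟩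
    · exact squeeze_zero_norm (fun n => (hs1 n).le) tendsto_one_div_add_atTop_nhds_zero_nat
    · exact squeeze_zero (fun n => hn _) (fun n => (hs2 n).le)
        tendsto_one_div_add_atTop_nhds_zero_nat
  have hdT : Dense (T.domain : Set H) := hd.mono hST.1
  refine ⟨hd, hsS, fun u => by rw [← assocForm_inclusion hST]; exact hn _, fun u w => ⟨?_, ?_⟩⟩
  · intro h
    obtain ⟨v, h1, h2⟩ := exists_seq_of_mem_closure_graph (isClosable_of_symmetric hdT hs) h
    exact key v h1 h2
  · rintro ⟨s, hsu, hsw⟩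
    refine (mem_closure_graph_iff hdT hs hn hr u w).2 fun y => ?_
    -- The constant sequence `y` yields test sequence `t` for the pair `(y, T y)`. Computing the
    -- limit of the form on `s` and `t` in both orders shows that `(u, w)` lies in the adjoint
    -- graph.
    obtain ⟨t, hty, htw⟩ := key (fun _ => y) tendsto_const_nhds tendsto_const_nhds
    refine tendsto_nhds_unique (hsw y t hty) ?_
    have h := (Complex.continuous_conj.tendsto _).comp (htw u s hsu)
    simpa only [Function.comp_def, conj_assocForm hsS, inner_conj_symm] using h

end HilbertSpace

/-! ### A criterion for realizations of the operator -/

section Realization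

variable {γ : ℝ} {V : Submodule ℂ (ℂ → ℂ)} {hV : V ≤ smoothInterior}

theorem realization_exists_rep (x : (realization γ V hV).domain) :
    ∃ f ∈ V, (x : L2 γ) =ᵐ[diskMeasure γ] f ∧
      realization γ V hV x =ᵐ[diskMeasure γ] keldyshOp γ f := by
  have h := (realization γ V hV).mem_graph x
  rw [realization_graph] at h
  exact h

theorem exists_realization_eq {f : ℂ → ℂ} (hf : f ∈ V) (h1 : MemLp f 2 (diskMeasure γ))
    (h2 : MemLp (keldyshOp γ f) 2 (diskMeasure γ)) :
    ∃ x : (realization γ V hV).domain, (x : L2 γ) = h1.toLp f ∧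
      realization γ V hV x = h2.toLp (keldyshOp γ f) := by
  have h : (h1.toLp f, h2.toLp (keldyshOp γ f)) ∈ (realization γ V hV).graph := by
    rw [realization_graph]
    exact ⟨f, hf, h1.coeFn_toLp, h2.coeFn_toLp⟩
  exact (LinearPMap.mem_graph_iff _).1 h

theorem realization_mono {W : Submodule ℂ (ℂ → ℂ)} {hW : W ≤ smoothInterior} (h : V ≤ W) :
    realization γ V hV ≤ realization γ W hW := by
  refine LinearPMap.le_of_le_graph ?_
  rw [realization_graph, realization_graph]
  rintro p ⟨f, hf, h1⟩
  exact ⟨f, h hf, h1⟩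

theorem inner_eq_integral {u v : L2 γ} {f g : ℂ → ℂ} (hu : u =ᵐ[diskMeasure γ] f)
    (hv : v =ᵐ[diskMeasure γ] g) :
    ⟪u, v⟫_ℂ = ∫ z, starRingEnd ℂ (f z) * g z ∂(diskMeasure γ) := by
  rw [L2.inner_def]
  refine integral_congr_ae ?_
  filter_upwards [hu, hv] with z h1 h2
  rw [h1, h2, RCLike.inner_apply, mul_comm]

/-- The data needed for the realization on `V` to be essentially self-adjoint with closure the
Friedrichs extension, in terms of functions. -/
structure IsFriedrichsCore (γ : ℝ) (V : Submodule ℂ (ℂ → ℂ)) : Prop where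
  memLp : ∀ f ∈ V, MemLp f 2 (diskMeasure γ) ∧ MemLp (keldyshOp γ f) 2 (diskMeasure γ)
  test_le : testFunctions ≤ V
  symm : ∀ f ∈ V, ∀ g ∈ V, ∫ z, starRingEnd ℂ (keldyshOp γ f z) * g z ∂(diskMeasure γ) =
    ∫ z, starRingEnd ℂ (f z) * keldyshOp γ g z ∂(diskMeasure γ)
  nonneg : ∀ f ∈ V, 0 ≤ (∫ z, starRingEnd ℂ (f z) * keldyshOp γ f z ∂(diskMeasure γ)).re
  dense : ∀ h : ℂ → ℂ, MemLp h 2 (diskMeasure γ) → ∀ ε > 0, ∃ f ∈ V,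
    eLpNorm (h - f) 2 (diskMeasure γ) < ENNReal.ofReal ε
  dense_range : ∀ h : ℂ → ℂ, MemLp h 2 (diskMeasure γ) → ∀ ε > 0, ∃ f ∈ V,
    eLpNorm (h - (keldyshOp γ f + f)) 2 (diskMeasure γ) < ENNReal.ofReal ε
  approx : ∀ f ∈ V, ∀ ε > 0, ∃ t ∈ testFunctions,
    eLpNorm (f - t) 2 (diskMeasure γ) < ENNReal.ofReal ε ∧
    (∫ z, starRingEnd ℂ ((f - t) z) * keldyshOp γ (f - t) z ∂(diskMeasure γ)).re < ε

theorem dist_toLp_lt {h f : ℂ → ℂ} {μ : Measure ℂ} (hh : MemLp h 2 μ) (hf : MemLp f 2 μ) {ε : ℝ}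
    (hlt : eLpNorm (h - f) 2 μ < ENNReal.ofReal ε) : ‖hh.toLp h - hf.toLp f‖ < ε := by
  rw [← MemLp.toLp_sub, Lp.norm_toLp]
  exact ENNReal.toReal_lt_of_lt_ofReal hlt


/-- Every element of the domain is the class of some `f ∈ V` whose image is the class of `L_γ f`, so
each integral condition on functions becomes a hypothesis of the abstract criteria. -/
theorem IsFriedrichsCore.isEssentiallySelfAdjoint_and_isFriedrichsExtension (hc : IsFriedrichsCore γ V) (hV : V ≤ smoothInterior) :
    (∀ f ∈ V, MemLp f 2 (diskMeasure γ) ∧ MemLp (keldyshOp γ f) 2 (diskMeasure γ)) ∧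
      IsEssentiallySelfAdjoint (realization γ V hV) ∧
      IsFriedrichsExtension (realization γ testFunctions testFunctions_le)
        (realization γ V hV).closure := by
  set T := realization γ V hV with hT
  have hd : Dense (T.domain : Set (L2 γ)) := by
    rw [Metric.dense_iff]
    intro h ε hε
    obtain ⟨f, hf, hlt⟩ := hc.dense h (Lp.memLp h) ε hε
    obtain ⟨x, hx, -⟩ := exists_realization_eq (hV := hV) hf (hc.memLp f hf).1 (hc.memLp f hf).2
    refine ⟨x, ?_, x.2⟩
    have := dist_toLp_lt (Lp.memLp h) (hc.memLp f hf).1 hlt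
    rwa [Lp.toLp_coeFn, ← hx, ← dist_eq_norm, dist_comm] at this
  have hs : T.IsFormalAdjoint T := by
    intro x y
    obtain ⟨f, hf, h1, h2⟩ := realization_exists_rep x
    obtain ⟨g, hg, h3, h4⟩ := realization_exists_rep y
    rw [inner_eq_integral h2 h3, inner_eq_integral h1 h4, hc.symm f hf g hg]
  have hn : ∀ u : T.domain, 0 ≤ (assocForm T u u).re := by
    intro x
    obtain ⟨f, hf, h1, h2⟩ := realization_exists_rep x
    rw [assocForm, inner_eq_integral h1 h2]
    exact hc.nonneg f hf
  have hr : DenseRange fun u : T.domain => T u + (u : L2 γ) := by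
    rw [DenseRange, Metric.dense_iff]
    intro h ε hε
    obtain ⟨f, hf, hlt⟩ := hc.dense_range h (Lp.memLp h) ε hε
    obtain ⟨x, hx, hx2⟩ := exists_realization_eq (hV := hV) hf (hc.memLp f hf).1 (hc.memLp f hf).2
    refine ⟨T x + x, ?_, x, rfl⟩
    have := dist_toLp_lt (Lp.memLp h) ((hc.memLp f hf).2.add (hc.memLp f hf).1) hlt
    rwa [Lp.toLp_coeFn, MemLp.toLp_add (hc.memLp f hf).2 (hc.memLp f hf).1, ← hx, ← hx2, ← dist_eq_norm, dist_comm] at this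
  have hST : realization γ testFunctions testFunctions_le ≤ T := realization_mono hc.test_le
  have happ : ∀ u : T.domain, ∀ ε > 0,
      ∃ s : (realization γ testFunctions testFunctions_le).domain, ‖(u : L2 γ) - s‖ < ε ∧
      (assocForm T (u - Submodule.inclusion hST.1 s) (u - Submodule.inclusion hST.1 s)).re < ε := by
    intro u ε hε
    obtain ⟨f, hf, h1, h2⟩ := realization_exists_rep u
    obtain ⟨t, ht, h3, h4⟩ := hc.approx f hf ε hε
    have ht' := hc.test_le ht
    obtain ⟨s, hs1, hs2⟩ := exists_realization_eq (hV := testFunctions_le) ht (hc.memLp t ht').1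
      (hc.memLp t ht').2
    refine ⟨s, ?_, ?_⟩
    · have := dist_toLp_lt (hc.memLp f hf).1 (hc.memLp t ht').1 h3
      rwa [← hs1, (Lp.ext ((MemLp.coeFn_toLp _).trans h1.symm) : (hc.memLp f hf).1.toLp f = u)]
        at this
    · have e1 : (u - Submodule.inclusion hST.1 s : T.domain) =ᵐ[diskMeasure γ] f - t := by
        rw [Submodule.coe_sub, Submodule.coe_inclusion, hs1]
        filter_upwards [Lp.coeFn_sub (u : L2 γ) ((hc.memLp t ht').1.toLp t), h1,
          (hc.memLp t ht').1.coeFn_toLp] with z a b c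
        rw [a, Pi.sub_apply, Pi.sub_apply, b, c]
      have e2 : T (u - Submodule.inclusion hST.1 s) =ᵐ[diskMeasure γ] keldyshOp γ (f - t) := by
        have e3 : T (Submodule.inclusion hST.1 s) = (hc.memLp t ht').2.toLp _ := by
          rw [← hs2]; exact (hST.2 rfl).symm
        rw [T.map_sub, e3]
        filter_upwards [Lp.coeFn_sub (T u) ((hc.memLp t ht').2.toLp _), h2,
          (hc.memLp t ht').2.coeFn_toLp, ae_mem_disk γ] with z a b c hz
        rw [a, Pi.sub_apply, b, c, sub_eq_add_neg f, ← neg_one_smul ℂ t,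
          keldyshOp_add γ (hV hf) (hV (V.smul_mem _ ht')) hz, Pi.add_apply,
          keldyshOp_smul γ _ (hV ht') hz]
        simp [sub_eq_add_neg]
      rw [assocForm, inner_eq_integral e1 e2]
      exact h4
  refine ⟨hc.memLp, isEssentiallySelfAdjoint_of_denseRange hd hs hn hr,
    isFriedrichsExtension_closure hST ?_ hs hn hr happ⟩
  -- Test functions are dense in `L²_γ` because they approximate the core, which is dense; each
  -- approximation costs `ε / 2`.
  rw [Metric.dense_iff]
  intro h ε hε
  obtain ⟨u, hu1, hu2⟩ := Metric.dense_iff.1 hd h (ε / 2) (by positivity)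
  obtain ⟨s, hs1, -⟩ := happ ⟨u, hu2⟩ (ε / 2) (by positivity)
  refine ⟨s, ?_, s.2⟩
  rw [Metric.mem_ball] at hu1 ⊢
  rw [← dist_eq_norm, dist_comm] at hs1
  exact (dist_triangle _ _ _).trans_lt (by linarith)

end Realization

/-! ### Derivatives along vector fields -/

/-- The derivative of `f` along the vector field `X`. -/
noncomputable def fieldDeriv (X f : ℂ → ℂ) (z : ℂ) : ℂ := fderiv ℝ f z (X z)

/-- The rotation vector field `∂_ω`. -/
noncomputable def rot (z : ℂ) : ℂ := Complex.I * z

theorem contDiff_rot {n : WithTop ℕ∞} : ContDiff ℝ n rot := contDiff_const.mul contDiff_id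

theorem angularDeriv_eq (f : ℂ → ℂ) : angularDeriv f = fieldDeriv rot f := rfl

theorem differentiableAt_of_disk {f : ℂ → ℂ} (hf : ContDiffOn ℝ ∞ f disk) {z : ℂ} (hz : z ∈ disk) :
    DifferentiableAt ℝ f z :=
  (hf.contDiffAt (isOpen_disk.mem_nhds hz)).differentiableAt (by simp)

theorem fieldDeriv_contDiffOn {X f : ℂ → ℂ} (hX : ContDiff ℝ ∞ X) (hf : ContDiffOn ℝ ∞ f disk) :
    ContDiffOn ℝ ∞ (fieldDeriv X f) disk :=
  (hf.fderiv_of_isOpen isOpen_disk (by simp)).clm_apply hX.contDiffOn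

theorem fieldDeriv_congr {X f g : ℂ → ℂ} (h : EqOn f g disk) :
    EqOn (fieldDeriv X f) (fieldDeriv X g) disk := by
  intro z hz
  have hfg : f =ᶠ[𝓝 z] g := h.eventuallyEq_of_mem (isOpen_disk.mem_nhds hz)
  simp only [fieldDeriv, hfg.fderiv_eq]

theorem fieldDeriv_add {X f g : ℂ → ℂ} {z : ℂ} (hf : DifferentiableAt ℝ f z)
    (hg : DifferentiableAt ℝ g z) :
    fieldDeriv X (fun w => f w + g w) z = fieldDeriv X f z + fieldDeriv X g z := by
  simp [fieldDeriv, fderiv_fun_add hf hg]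

theorem fieldDeriv_mul {X f g : ℂ → ℂ} {z : ℂ} (hf : DifferentiableAt ℝ f z)
    (hg : DifferentiableAt ℝ g z) :
    fieldDeriv X (fun w => f w * g w) z = f z * fieldDeriv X g z + g z * fieldDeriv X f z := by
  simp [fieldDeriv, fderiv_fun_mul hf hg]

theorem fieldDeriv_conj (X f : ℂ → ℂ) (z : ℂ) :
    fieldDeriv X (fun w => starRingEnd ℂ (f w)) z = starRingEnd ℂ (fieldDeriv X f z) := by
  have h : (fun w => starRingEnd ℂ (f w)) = Complex.conjCLE ∘ f := by ext; simp
  rw [fieldDeriv, h, Complex.conjCLE.comp_fderiv]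
  rfl

theorem fieldDeriv_fieldDeriv_mul {X f g : ℂ → ℂ} (hX : ContDiff ℝ ∞ X)
    (hf : ContDiffOn ℝ ∞ f disk) (hg : ContDiffOn ℝ ∞ g disk) {z : ℂ} (hz : z ∈ disk) :
    fieldDeriv X (fieldDeriv X fun w => f w * g w) z =
      f z * fieldDeriv X (fieldDeriv X g) z + 2 * fieldDeriv X f z * fieldDeriv X g z
        + g z * fieldDeriv X (fieldDeriv X f) z := by
  have h1 : EqOn (fieldDeriv X fun w => f w * g w)
      (fun w => f w * fieldDeriv X g w + g w * fieldDeriv X f w) disk := fun w hw =>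
    fieldDeriv_mul (differentiableAt_of_disk hf hw) (differentiableAt_of_disk hg hw)
  have df := differentiableAt_of_disk hf hz
  have dg := differentiableAt_of_disk hg hz
  have dXf := differentiableAt_of_disk (fieldDeriv_contDiffOn hX hf) hz
  have dXg := differentiableAt_of_disk (fieldDeriv_contDiffOn hX hg) hz
  rw [fieldDeriv_congr h1 hz, fieldDeriv_add (df.fun_mul dXg) (dg.fun_mul dXf), fieldDeriv_mul df dXg,
    fieldDeriv_mul dg dXf]
  ring

theorem laplacian_eq_fieldDeriv {f : ℂ → ℂ} (hf : ContDiffOn ℝ ∞ f disk) {z : ℂ} (hz : z ∈ disk) :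
    Laplacian.laplacian f z = fieldDeriv (fun _ => 1) (fieldDeriv (fun _ => 1) f) z +
      fieldDeriv (fun _ => Complex.I) (fieldDeriv (fun _ => Complex.I) f) z := by
  have h1 : DifferentiableAt ℝ (fderiv ℝ f) z :=
    ((hf.fderiv_of_isOpen isOpen_disk (by simp : (∞ : WithTop ℕ∞) + 1 ≤ ∞)).contDiffAt
      (isOpen_disk.mem_nhds hz)).differentiableAt (by simp)
  rw [InnerProductSpace.laplacian_eq_iteratedFDeriv_complexPlane]
  have h2 : ∀ v : ℂ, fieldDeriv (fun _ => v) (fieldDeriv (fun _ => v) f) z =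
      fderiv ℝ (fderiv ℝ f) z v v := by
    intro v
    have := (h1.hasFDerivAt.clm_apply (hasFDerivAt_const v z)).fderiv
    unfold fieldDeriv
    rw [this]
    simp
  simp [iteratedFDeriv_two_apply, h2]

theorem fderiv_eq_fieldDeriv (f : ℂ → ℂ) (z v : ℂ) :
    fderiv ℝ f z v = v.re * fieldDeriv (fun _ => 1) f z +
      v.im * fieldDeriv (fun _ => Complex.I) f z := by
  have h : v = (v.re : ℝ) • (1 : ℂ) + (v.im : ℝ) • Complex.I := by simp [Complex.re_add_im]
  conv_lhs => rw [h, map_add, map_smul, map_smul]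
  simp [fieldDeriv]

/-- With only derivatives along `1`, `I` and `rot` present, the Leibniz rule reduces the later
operator identities to ring identities. -/
theorem keldyshOp_eq_fieldDeriv (γ : ℝ) {f : ℂ → ℂ} (hf : ContDiffOn ℝ ∞ f disk) {z : ℂ}
    (hz : z ∈ disk) :
    keldyshOp γ f z =
      -(bdf z : ℂ) * (fieldDeriv (fun _ => 1) (fieldDeriv (fun _ => 1) f) z +
        fieldDeriv (fun _ => Complex.I) (fieldDeriv (fun _ => Complex.I) f) z)
      + (2 + 2 * (γ : ℂ)) * (z.re * fieldDeriv (fun _ => 1) f z +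
          z.im * fieldDeriv (fun _ => Complex.I) f z)
      - fieldDeriv rot (fieldDeriv rot f) z + ((γ : ℂ) + 1) ^ 2 * f z := by
  rw [keldyshOp, laplacian_eq_fieldDeriv hf hz, radialDeriv, fderiv_eq_fieldDeriv]
  rfl

/-! ### Powers of the boundary defining function -/

theorem bdf_eq (z : ℂ) : bdf z = 1 - (z.re ^ 2 + z.im ^ 2) := by
  rw [bdf, Complex.sq_norm, Complex.normSq_apply]; ring

theorem hasFDerivAt_bdf (z : ℂ) :
    HasFDerivAt bdf (-((2 * z.re) • Complex.reCLM + (2 * z.im) • Complex.imCLM)) z := by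
  have h : HasFDerivAt (fun z : ℂ => 1 - (z.re ^ 2 + z.im ^ 2)) _ z :=
    ((Complex.reCLM.hasFDerivAt.pow 2).add (Complex.imCLM.hasFDerivAt.pow 2)).const_sub 1
  rw [show bdf = fun z : ℂ => 1 - (z.re ^ 2 + z.im ^ 2) from funext bdf_eq]
  refine h.congr_fderiv ?_
  ext; simp

theorem contDiff_bdf {n : WithTop ℕ∞} : ContDiff ℝ n bdf :=
  contDiff_const.sub (contDiff_norm_sq ℝ)

/-- The function `x ^ s` with complex values. -/
noncomputable def bdfPow (s : ℝ) (z : ℂ) : ℂ := ((bdf z ^ s : ℝ) : ℂ)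

theorem bdfPow_contDiffOn (s : ℝ) : ContDiffOn ℝ ∞ (bdfPow s) disk :=
  Complex.ofRealCLM.contDiff.comp_contDiffOn
    (contDiff_bdf.contDiffOn.rpow_const_of_ne fun _ hz => (bdf_pos hz).ne')

theorem bdfPow_add {z : ℂ} (hz : z ∈ disk) (s t : ℝ) :
    bdfPow (s + t) z = bdfPow s z * bdfPow t z := by
  simp only [bdfPow, Real.rpow_add (bdf_pos hz), Complex.ofReal_mul]

theorem bdfPow_one (z : ℂ) : bdfPow 1 z = bdf z := by simp [bdfPow]

theorem fieldDeriv_bdfPow (X : ℂ → ℂ) (s : ℝ) {z : ℂ} (hz : z ∈ disk) :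
    fieldDeriv X (bdfPow s) z =
      -(2 * s * bdfPow (s - 1) z * (z.re * (X z).re + z.im * (X z).im)) := by
  have h1 := (hasFDerivAt_bdf z).rpow_const (p := s) (Or.inl (bdf_pos hz).ne')
  have h2 : HasFDerivAt (bdfPow s) _ z := Complex.ofRealCLM.hasFDerivAt.comp z h1
  rw [fieldDeriv, h2.fderiv]
  simp [bdfPow]
  ring

/-- Powers of `x` are rotation invariant. -/
theorem fieldDeriv_rot_bdfPow (s : ℝ) {z : ℂ} (hz : z ∈ disk) : fieldDeriv rot (bdfPow s) z = 0 := by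
  rw [fieldDeriv_bdfPow rot s hz]
  simp [rot]
  ring_nf
  simp

theorem fieldDeriv_ofReal_apply {l : ℂ →L[ℝ] ℝ} (X : ℂ → ℂ) (z : ℂ) :
    fieldDeriv X (fun w => ((l w : ℝ) : ℂ)) z = l (X z) := by
  have h : HasFDerivAt (fun w => ((l w : ℝ) : ℂ)) (Complex.ofRealCLM.comp l) z :=
    (Complex.ofRealCLM.comp l).hasFDerivAt
  rw [fieldDeriv, h.fderiv]
  simp

/-! ### Conjugation by a power of the boundary defining function -/

/-- The functional `l` is the coordinate in direction `v`, so one computation covers both `∂_x` and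
`∂_y`. -/
theorem fieldDeriv_fieldDeriv_bdfPow (s : ℝ) {v : ℂ} {l : ℂ →L[ℝ] ℝ}
    (hl : ∀ w, l w = w.re * v.re + w.im * v.im) {z : ℂ} (hz : z ∈ disk) :
    fieldDeriv (fun _ => v) (fieldDeriv (fun _ => v) (bdfPow s)) z =
      -(2 * s) * (bdfPow (s - 1) z * l v - 2 * (s - 1) * bdfPow (s - 2) z * l z ^ 2) := by
  have h : EqOn (fieldDeriv (fun _ => v) (bdfPow s))
      (fun w => (-(2 * s) * bdfPow (s - 1) w) * ((l w : ℝ) : ℂ)) disk := fun w hw => by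
    simp only [fieldDeriv_bdfPow _ _ hw, hl]; push_cast; ring
  have d1 := differentiableAt_of_disk (bdfPow_contDiffOn (s - 1)) hz
  have d2 : DifferentiableAt ℝ (fun w => ((l w : ℝ) : ℂ)) z :=
    (Complex.ofRealCLM.comp l).differentiableAt
  rw [fieldDeriv_congr h hz, fieldDeriv_mul (d1.const_mul _) d2, fieldDeriv_ofReal_apply,
    fieldDeriv_mul (differentiableAt_const _) d1, fieldDeriv_bdfPow _ _ hz, hl z]
  simp [fieldDeriv, show s - 1 - 1 = s - 2 by ring]
  ring

/-- The cross term of `-xΔ` turns the coefficient `2 + 2γ` of `ρ∂_ρ` into `2 - 2γ`. The terms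
`4γ(γ+1)ρ² x^{-γ-1}` cancel between the Laplacian and the radial derivative, and the remaining `-4γ`
turns `(γ+1)²` into `(1-γ)²`. -/
theorem keldyshOp_bdfPow_mul (γ : ℝ) {g : ℂ → ℂ} (hg : ContDiffOn ℝ ∞ g disk) {z : ℂ}
    (hz : z ∈ disk) :
    keldyshOp γ (fun w => bdfPow (-γ) w * g w) z = bdfPow (-γ) z * keldyshOp (-γ) g z := by
  have hb := bdfPow_contDiffOn (-γ)
  have db := differentiableAt_of_disk hb hz
  have dg := differentiableAt_of_disk hg hz
  have hrot : fieldDeriv rot (fieldDeriv rot (bdfPow (-γ))) z = 0 := by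
    have h : EqOn (fieldDeriv rot (bdfPow (-γ))) (fun _ => 0) disk := fun w hw =>
      fieldDeriv_rot_bdfPow _ hw
    rw [fieldDeriv_congr h hz]
    simp [fieldDeriv]
  rw [keldyshOp_eq_fieldDeriv γ (hb.mul hg) hz, keldyshOp_eq_fieldDeriv (-γ) hg hz,
    fieldDeriv_fieldDeriv_mul contDiff_const hb hg hz,
    fieldDeriv_fieldDeriv_mul contDiff_const hb hg hz,
    fieldDeriv_fieldDeriv_mul contDiff_rot hb hg hz, fieldDeriv_mul db dg, fieldDeriv_mul db dg,
    hrot, fieldDeriv_rot_bdfPow _ hz,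
    fieldDeriv_fieldDeriv_bdfPow (v := 1) (l := Complex.reCLM) _
      (by simp) hz, fieldDeriv_fieldDeriv_bdfPow (v := Complex.I) (l := Complex.imCLM) _ (by simp) hz,
    fieldDeriv_bdfPow _ _ hz, fieldDeriv_bdfPow _ _ hz]
  -- Expressing every power through the lowest one, `x^{-γ-2}`, leaves a polynomial identity.
  have e1 : bdfPow (-γ - 1) z = bdfPow (-γ - 2) z * bdf z := by
    rw [← bdfPow_one, ← bdfPow_add hz]; ring_nf
  have e2 : bdfPow (-γ) z = bdfPow (-γ - 2) z * bdf z * bdf z := by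
    rw [← bdfPow_one, ← bdfPow_add hz, ← bdfPow_add hz]; ring_nf
  rw [e1, e2, bdf_eq]
  push_cast
  simp only [Complex.one_re, Complex.one_im, Complex.I_re, Complex.I_im, Complex.ofReal_one,
    Complex.ofReal_zero, Complex.reCLM_apply, Complex.imCLM_apply]
  ring

/-! ### Weighted integrals and multiplication by powers of `x` -/

theorem measurable_bdf : Measurable bdf := by
  unfold bdf; fun_prop

theorem measurable_bdfPow (s : ℝ) : Measurable (bdfPow s) :=
  Complex.measurable_ofReal.comp (measurable_bdf.pow_const s)

theorem measurable_weight (γ : ℝ) : Measurable fun z => ENNReal.ofReal (bdf z ^ γ) :=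
  (measurable_bdf.pow_const γ).ennreal_ofReal

theorem integral_diskMeasure (γ : ℝ) (F : ℂ → ℂ) :
    ∫ z, F z ∂(diskMeasure γ) = ∫ z in disk, bdfPow γ z * F z := by
  rw [diskMeasure, integral_withDensity_eq_integral_toReal_smul (measurable_weight γ) (by simp)]
  refine setIntegral_congr_fun isOpen_disk.measurableSet fun z hz => ?_
  simp only [ENNReal.toReal_ofReal (Real.rpow_nonneg (bdf_pos hz).le γ), bdfPow, Complex.real_smul]

theorem lintegral_diskMeasure (γ : ℝ) (F : ℂ → ENNReal) :
    ∫⁻ z, F z ∂(diskMeasure γ) = ∫⁻ z in disk, ENNReal.ofReal (bdf z ^ γ) * F z := by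
  rw [diskMeasure, lintegral_withDensity_eq_lintegral_mul_non_measurable _ (measurable_weight γ)
    (by simp)]
  rfl

theorem eLpNorm_two_sq {μ : Measure ℂ} (F : ℂ → ℂ) :
    eLpNorm F 2 μ = (∫⁻ z, ‖F z‖ₑ ^ 2 ∂μ) ^ (1 / 2 : ℝ) := by
  rw [eLpNorm_eq_lintegral_rpow_enorm_toReal (by simp) (by simp)]
  simp

/-- The weights match: `(x^{-γ})² x^γ = x^{-γ}`. -/
theorem eLpNorm_bdfPow_mul (γ : ℝ) {F G : ℂ → ℂ}
    (h : ∀ z ∈ disk, F z = bdfPow (-γ) z * G z) :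
    eLpNorm F 2 (diskMeasure γ) = eLpNorm G 2 (diskMeasure (-γ)) := by
  rw [eLpNorm_two_sq, eLpNorm_two_sq, lintegral_diskMeasure, lintegral_diskMeasure]
  congr 1
  refine setLIntegral_congr_fun isOpen_disk.measurableSet fun z hz => ?_
  have hx := bdf_pos hz
  simp only [h z hz, enorm_mul, mul_pow, ← mul_assoc]
  congr 1
  have : ‖bdfPow (-γ) z‖ₑ = ENNReal.ofReal (bdf z ^ (-γ)) := by
    rw [← ofReal_norm, bdfPow, Complex.norm_real,
      Real.norm_of_nonneg (Real.rpow_nonneg hx.le _)]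
  rw [this, ← ENNReal.ofReal_pow (Real.rpow_nonneg hx.le _),
    ← ENNReal.ofReal_mul (Real.rpow_nonneg hx.le _), ← Real.rpow_natCast, ← Real.rpow_mul hx.le,
    ← Real.rpow_add hx]
  congr 2
  push_cast
  ring

theorem diskMeasure_ac (γ δ : ℝ) : diskMeasure γ ≪ diskMeasure δ := by
  refine Measure.AbsolutelyContinuous.mk fun s _ hs => ?_
  rw [measure_eq_zero_iff_ae_notMem] at hs ⊢
  rw [ae_restrict_iff_ae_diskMeasure] at hs ⊢
  exact hs

theorem memLp_bdfPow_mul (γ : ℝ) {F G : ℂ → ℂ}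
    (h : ∀ z ∈ disk, F z = bdfPow (-γ) z * G z) (hG : MemLp G 2 (diskMeasure (-γ))) :
    MemLp F 2 (diskMeasure γ) := by
  refine ⟨?_, ?_⟩
  · refine (((measurable_bdfPow (-γ)).aestronglyMeasurable.mul hG.1).mono_ac
      (diskMeasure_ac γ (-γ))).congr ?_
    filter_upwards [ae_mem_disk γ] with z hz using (h z hz).symm
  · rw [eLpNorm_bdfPow_mul γ h]; exact hG.2

theorem integral_bdfPow_mul (γ : ℝ) {F G F' G' : ℂ → ℂ}
    (h : ∀ z ∈ disk, F z = bdfPow (-γ) z * G z) (h' : ∀ z ∈ disk, F' z = bdfPow (-γ) z * G' z) :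
    ∫ z, starRingEnd ℂ (F z) * F' z ∂(diskMeasure γ) =
      ∫ z, starRingEnd ℂ (G z) * G' z ∂(diskMeasure (-γ)) := by
  rw [integral_diskMeasure, integral_diskMeasure]
  refine setIntegral_congr_fun isOpen_disk.measurableSet fun z hz => ?_
  have e : bdfPow γ z * bdfPow (-γ) z = 1 := by rw [← bdfPow_add hz]; simp [bdfPow]
  have e' : starRingEnd ℂ (bdfPow (-γ) z) = bdfPow (-γ) z := Complex.conj_ofReal _
  simp only [h z hz, h' z hz, map_mul, e']
  linear_combination (bdfPow (-γ) z * starRingEnd ℂ (G z) * G' z) * e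

/-- The factor `a` may be singular at the boundary or arbitrary outside the disk, since the product
vanishes off the support of `t`. -/
theorem mul_mem_testFunctions {a t : ℂ → ℂ} (ha : ContDiffOn ℝ ∞ a disk)
    (ht : t ∈ testFunctions) : (fun z => a z * t z) ∈ testFunctions := by
  obtain ⟨h1, h2, h3⟩ := ht
  have h4 : tsupport (fun z => a z * t z) ⊆ tsupport t := tsupport_mul_subset_right
  refine ⟨?_, h2.mul_left, h4.trans h3⟩
  rw [contDiff_iff_contDiffAt]
  intro z
  by_cases hz : z ∈ tsupport t
  · exact (ha.contDiffAt (isOpen_disk.mem_nhds (h3 hz))).mul h1.contDiffAt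
  · have : (fun z => a z * t z) =ᶠ[𝓝 z] fun _ => 0 := by
      filter_upwards [(isClosed_tsupport t).isOpen_compl.mem_nhds hz] with w hw
      rw [image_eq_zero_of_notMem_tsupport hw, mul_zero]
    exact contDiffAt_const.congr_of_eventuallyEq this

/-- Multiplication by `x ^ (-γ)` takes the realization of `L_{-γ}` on `C^∞(𝔻)` to that of `L_γ` on
`x ^ (-γ) C^∞(𝔻)`. -/
theorem IsFriedrichsCore.weightedSmooth {γ : ℝ} (hc : IsFriedrichsCore (-γ) smoothClosed) :
    IsFriedrichsCore γ (weightedSmooth (-γ)) := by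
  have hL : ∀ {f g : ℂ → ℂ}, g ∈ smoothClosed → (∀ z ∈ disk, f z = bdfPow (-γ) z * g z) →
      ∀ z ∈ disk, keldyshOp γ f z = bdfPow (-γ) z * keldyshOp (-γ) g z := by
    intro f g hg h z hz
    rw [← keldyshOp_bdfPow_mul γ (smoothClosed_le hg) hz]
    exact keldyshOp_congr γ h hz
  have hmem : ∀ {g : ℂ → ℂ}, g ∈ smoothClosed →
      (fun z => bdfPow (-γ) z * g z) ∈ KeldyshDisk.weightedSmooth (-γ) := fun hg =>
    ⟨_, hg, fun _ _ => rfl⟩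
  have hinv : ∀ z ∈ disk, bdfPow (-γ) z * bdfPow γ z = 1 := fun z hz => by
    rw [← bdfPow_add hz]; simp [bdfPow]
  have hmul : ∀ h : ℂ → ℂ, ∀ z ∈ disk, h z = bdfPow (-γ) z * (bdfPow γ z * h z) := fun h z hz => by
    rw [← mul_assoc, hinv z hz, one_mul]
  have hmemLp : ∀ {h : ℂ → ℂ}, MemLp h 2 (diskMeasure γ) →
      MemLp (fun z => bdfPow γ z * h z) 2 (diskMeasure (-γ)) := fun {h} hh => by
    refine memLp_bdfPow_mul (-γ) (G := h) (fun z _ => by rw [neg_neg]) ?_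
    rwa [neg_neg]
  refine ⟨?_, ?_, ?_, ?_, ?_, ?_, ?_⟩
  · rintro f ⟨g, hg, h⟩
    exact ⟨memLp_bdfPow_mul γ h (hc.memLp g hg).1, memLp_bdfPow_mul γ (hL hg h) (hc.memLp g hg).2⟩
  · intro t ht
    exact ⟨_, hc.test_le (mul_mem_testFunctions (bdfPow_contDiffOn γ) ht), hmul t⟩
  · rintro f ⟨g, hg, h⟩ f' ⟨g', hg', h'⟩
    rw [integral_bdfPow_mul γ (hL hg h) h', integral_bdfPow_mul γ h (hL hg' h')]
    exact hc.symm g hg g' hg'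
  · rintro f ⟨g, hg, h⟩
    rw [integral_bdfPow_mul γ h (hL hg h)]
    exact hc.nonneg g hg
  · intro h hh ε hε
    obtain ⟨g, hg, hlt⟩ := hc.dense _ (hmemLp hh) ε hε
    refine ⟨_, hmem hg, ?_⟩
    rwa [eLpNorm_bdfPow_mul γ (G := (fun z => bdfPow γ z * h z) - g)]
    intro z hz
    rw [Pi.sub_apply, hmul h z hz, Pi.sub_apply]
    ring
  · intro h hh ε hε
    obtain ⟨g, hg, hlt⟩ := hc.dense_range _ (hmemLp hh) ε hε
    refine ⟨_, hmem hg, ?_⟩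
    rwa [eLpNorm_bdfPow_mul γ (G := (fun z => bdfPow γ z * h z) - (keldyshOp (-γ) g + g))]
    intro z hz
    rw [Pi.sub_apply, hmul h z hz, Pi.sub_apply, Pi.add_apply, Pi.add_apply,
      hL hg (fun _ _ => rfl) z hz]
    ring
  · rintro f ⟨g, hg, h⟩ ε hε
    obtain ⟨t, ht, h1, h2⟩ := hc.approx g hg ε hε
    have hsub : ∀ z ∈ disk, (f - fun z => bdfPow (-γ) z * t z) z = bdfPow (-γ) z * (g - t) z := by
      intro z hz
      rw [Pi.sub_apply, Pi.sub_apply, h z hz, mul_sub]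
      rfl
    refine ⟨_, mul_mem_testFunctions (bdfPow_contDiffOn (-γ)) ht, ?_, ?_⟩
    · rwa [eLpNorm_bdfPow_mul γ hsub]
    · rwa [integral_bdfPow_mul γ hsub (hL (sub_mem hg (hc.test_le ht)) hsub)]

/-! ### Integration by parts -/

theorem integrable_of_mem_testFunctions {t : ℂ → ℂ} (ht : t ∈ testFunctions) : Integrable t :=
  ht.1.continuous.integrable_of_hasCompactSupport ht.2.1

theorem setIntegral_disk_testFunction {t : ℂ → ℂ} (ht : t ∈ testFunctions) :
    ∫ z in disk, t z = ∫ z, t z :=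
  setIntegral_eq_integral_of_forall_compl_eq_zero fun _ hz =>
    image_eq_zero_of_notMem_tsupport fun h => hz (ht.2.2 h)

theorem fieldDeriv_mem_testFunctions {X t : ℂ → ℂ} (hX : ContDiff ℝ ∞ X) (ht : t ∈ testFunctions) :
    fieldDeriv X t ∈ testFunctions := by
  have h : tsupport (fieldDeriv X t) ⊆ tsupport t := by
    refine closure_minimal (fun z hz => ?_) (isClosed_tsupport t)
    refine tsupport_fderiv_subset ℝ (subset_tsupport _ fun h0 => hz ?_)
    rw [fieldDeriv, h0]
    rfl
  exact ⟨(ht.1.fderiv_right (m := ∞) (by simp)).clm_apply hX, ht.2.1.of_isClosed_subset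
    (isClosed_tsupport _) h, h.trans ht.2.2⟩

theorem integral_fieldDeriv_const (v : ℂ) {t : ℂ → ℂ} (ht : t ∈ testFunctions) :
    ∫ z, fieldDeriv (fun _ => v) t z = 0 := by
  have h1 : Integrable fun z => fderiv ℝ t z v := integrable_of_mem_testFunctions
    (fieldDeriv_mem_testFunctions (contDiff_const (c := v)) ht)
  -- Integration by parts against the constant function `1`.
  have h := integral_mul_fderiv_eq_neg_fderiv_mul_of_integrable (μ := volume)
    (f := fun _ : ℂ => (1 : ℂ)) (g := t) (v := v) (by simp) (by simpa using h1)
    (by simpa using integrable_of_mem_testFunctions ht)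
    (fun _ _ => differentiableAt_const _) fun z _ => ht.1.contDiffAt.differentiableAt (by simp)
  simpa [fieldDeriv] using h

theorem contDiffOn_ofReal_clm (l : ℂ →L[ℝ] ℝ) (s : Set ℂ) :
    ContDiffOn ℝ ∞ (fun w => ((l w : ℝ) : ℂ)) s :=
  (Complex.ofRealCLM.comp l).contDiff.contDiffOn

/-- The rotation field `(-y, x)` is divergence free, so `∂_ω t = ∂_x(-y t) + ∂_y(x t)`. -/
theorem integral_fieldDeriv_rot {t : ℂ → ℂ} (ht : t ∈ testFunctions) :
    ∫ z, fieldDeriv rot t z = 0 := by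
  have h1 := mul_mem_testFunctions (contDiffOn_ofReal_clm (-Complex.imCLM) disk) ht
  have h2 := mul_mem_testFunctions (contDiffOn_ofReal_clm Complex.reCLM disk) ht
  have e : ∀ z, fieldDeriv rot t z =
      fieldDeriv (fun _ => 1) (fun w => (((-Complex.imCLM) w : ℝ) : ℂ) * t w) z +
      fieldDeriv (fun _ => Complex.I) (fun w => ((Complex.reCLM w : ℝ) : ℂ) * t w) z := by
    intro z
    have dt : DifferentiableAt ℝ t z := ht.1.contDiffAt.differentiableAt (by simp)
    have d1 : DifferentiableAt ℝ (fun w => (((-Complex.imCLM) w : ℝ) : ℂ)) z :=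
      (Complex.ofRealCLM.comp (-Complex.imCLM)).differentiableAt
    have d2 : DifferentiableAt ℝ (fun w => ((Complex.reCLM w : ℝ) : ℂ)) z :=
      (Complex.ofRealCLM.comp Complex.reCLM).differentiableAt
    rw [fieldDeriv_mul d1 dt, fieldDeriv_mul d2 dt, fieldDeriv_ofReal_apply,
      fieldDeriv_ofReal_apply, fieldDeriv, fderiv_eq_fieldDeriv]
    simp [rot]
  simp only [e]
  rw [integral_add (integrable_of_mem_testFunctions (fieldDeriv_mem_testFunctions contDiff_const h1))
    (integrable_of_mem_testFunctions (fieldDeriv_mem_testFunctions contDiff_const h2)),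
    integral_fieldDeriv_const _ h1, integral_fieldDeriv_const _ h2, add_zero]

/-- The bilinear energy density of `L_γ`, with the weight `x ^ γ` included. -/
noncomputable def energy (γ : ℝ) (f h : ℂ → ℂ) (z : ℂ) : ℂ :=
  bdfPow (γ + 1) z * (fieldDeriv (fun _ => 1) f z * fieldDeriv (fun _ => 1) h z +
    fieldDeriv (fun _ => Complex.I) f z * fieldDeriv (fun _ => Complex.I) h z) +
  bdfPow γ z * (fieldDeriv rot f z * fieldDeriv rot h z + ((γ : ℂ) + 1) ^ 2 * (f z * h z))

/-- With its weight the operator is in divergence form, `x^γ L_γ f = -∂_x(x^{γ+1} ∂_x f) -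
∂_y(x^{γ+1} ∂_y f) - ∂_ω(x^γ ∂_ω f) + (γ+1)² x^γ f`; the drift term `(2 + 2γ) ρ∂_ρ` comes from
differentiating `x^{γ+1}`. -/
theorem energy_eq_keldyshOp_add_div (γ : ℝ) {f h : ℂ → ℂ} (hf : ContDiffOn ℝ ∞ f disk)
    (hh : ContDiffOn ℝ ∞ h disk) {z : ℂ} (hz : z ∈ disk) :
    bdfPow γ z * (keldyshOp γ f z * h z) = energy γ f h z
      - fieldDeriv (fun _ => 1) (fun w => (bdfPow (γ + 1) w * fieldDeriv (fun _ => 1) f w) * h w) z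
      - fieldDeriv (fun _ => Complex.I)
          (fun w => (bdfPow (γ + 1) w * fieldDeriv (fun _ => Complex.I) f w) * h w) z
      - fieldDeriv rot (fun w => (bdfPow γ w * fieldDeriv rot f w) * h w) z := by
  have db := differentiableAt_of_disk (bdfPow_contDiffOn (γ + 1)) hz
  have db' := differentiableAt_of_disk (bdfPow_contDiffOn γ) hz
  have dh := differentiableAt_of_disk hh hz
  have d1 := differentiableAt_of_disk (fieldDeriv_contDiffOn (X := fun _ => 1) contDiff_const hf) hz
  have d2 := differentiableAt_of_disk
    (fieldDeriv_contDiffOn (X := fun _ => Complex.I) contDiff_const hf) hz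
  have d3 := differentiableAt_of_disk (fieldDeriv_contDiffOn contDiff_rot hf) hz
  rw [keldyshOp_eq_fieldDeriv γ hf hz, energy, fieldDeriv_mul (db.fun_mul d1) dh,
    fieldDeriv_mul db d1, fieldDeriv_mul (db.fun_mul d2) dh, fieldDeriv_mul db d2,
    fieldDeriv_mul (db'.fun_mul d3) dh, fieldDeriv_mul db' d3, fieldDeriv_rot_bdfPow _ hz,
    fieldDeriv_bdfPow _ _ hz, fieldDeriv_bdfPow _ _ hz, bdfPow_add hz, bdfPow_one,
    add_sub_cancel_right]
  simp
  ring

/-- Compact support of `h` makes the three fields under the divergence test functions, so no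
boundary behaviour of `f` enters and `γ` is arbitrary. -/
theorem integral_keldyshOp_mul_testFunction (γ : ℝ) {f h : ℂ → ℂ} (hf : ContDiffOn ℝ ∞ f disk)
    (hh : h ∈ testFunctions) :
    ∫ z in disk, bdfPow γ z * (keldyshOp γ f z * h z) = ∫ z in disk, energy γ f h z := by
  have hb := bdfPow_contDiffOn γ
  have hb1 := bdfPow_contDiffOn (γ + 1)
  have c1 : ContDiff ℝ ∞ fun _ : ℂ => (1 : ℂ) := contDiff_const
  have cI : ContDiff ℝ ∞ fun _ : ℂ => Complex.I := contDiff_const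
  have t1 := mul_mem_testFunctions (hb1.mul (fieldDeriv_contDiffOn c1 hf)) hh
  have t2 := mul_mem_testFunctions (hb1.mul (fieldDeriv_contDiffOn cI hf)) hh
  have t3 := mul_mem_testFunctions (hb.mul (fieldDeriv_contDiffOn contDiff_rot hf)) hh
  have te : energy γ f h ∈ testFunctions := by
    have a1 := mul_mem_testFunctions (hb1.mul (fieldDeriv_contDiffOn c1 hf))
      (fieldDeriv_mem_testFunctions c1 hh)
    have a2 := mul_mem_testFunctions (hb1.mul (fieldDeriv_contDiffOn cI hf))
      (fieldDeriv_mem_testFunctions cI hh)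
    have a3 := mul_mem_testFunctions (hb.mul (fieldDeriv_contDiffOn contDiff_rot hf))
      (fieldDeriv_mem_testFunctions contDiff_rot hh)
    have a4 := mul_mem_testFunctions (hb.mul ((contDiffOn_const (c := ((γ : ℂ) + 1) ^ 2)).mul hf)) hh
    convert add_mem (add_mem a1 a2) (add_mem a3 a4) using 1
    ext z
    simp only [energy, Pi.add_apply]
    ring
  have u1 := fieldDeriv_mem_testFunctions c1 t1
  have u2 := fieldDeriv_mem_testFunctions cI t2
  have u3 := fieldDeriv_mem_testFunctions contDiff_rot t3
  have ie := (integrable_of_mem_testFunctions te).integrableOn (s := disk)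
  have i1 := (integrable_of_mem_testFunctions u1).integrableOn (s := disk)
  have i2 := (integrable_of_mem_testFunctions u2).integrableOn (s := disk)
  have i3 := (integrable_of_mem_testFunctions u3).integrableOn (s := disk)
  refine (setIntegral_congr_fun isOpen_disk.measurableSet fun z hz =>
    energy_eq_keldyshOp_add_div γ hf (testFunctions_le hh) hz).trans ?_
  refine (integral_sub ((ie.sub i1).sub i2) i3).trans ?_
  refine (congrArg (· - _) ((integral_sub (ie.sub i1) i2).trans
    (congrArg (· - _) (integral_sub ie i1)))).trans ?_
  rw [setIntegral_disk_testFunction u1, setIntegral_disk_testFunction u2,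
    setIntegral_disk_testFunction u3, integral_fieldDeriv_const _ t1, integral_fieldDeriv_const _ t2,
    integral_fieldDeriv_rot t3]
  simp

/-! ### Polynomials in `z` and its conjugate -/

/-- The monomial `z ^ a * conj z ^ b`. -/
noncomputable def monomial (a b : ℕ) (z : ℂ) : ℂ := z ^ a * starRingEnd ℂ z ^ b

/-- Polynomials in `z` and its conjugate. -/
noncomputable def polynomials : Submodule ℂ (ℂ → ℂ) :=
  Submodule.span ℂ (range fun p : ℕ × ℕ => monomial p.1 p.2)

theorem contDiff_pow {n : WithTop ℕ∞} (a : ℕ) : ContDiff ℝ n fun z : ℂ => z ^ a := contDiff_id.pow a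

theorem contDiff_conj_pow {n : WithTop ℕ∞} (b : ℕ) :
    ContDiff ℝ n fun z : ℂ => starRingEnd ℂ z ^ b :=
  (Complex.conjCLE.contDiff).pow b

theorem contDiff_monomial {n : WithTop ℕ∞} (a b : ℕ) : ContDiff ℝ n (monomial a b) :=
  (contDiff_pow a).mul (contDiff_conj_pow b)

theorem monomial_mem_smoothClosed (a b : ℕ) : monomial a b ∈ smoothClosed :=
  ⟨_, contDiff_monomial a b, fun _ _ => rfl⟩

theorem polynomials_le_smoothClosed : polynomials ≤ smoothClosed := by
  refine Submodule.span_le.2 ?_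
  rintro _ ⟨p, rfl⟩
  exact monomial_mem_smoothClosed _ _

theorem fieldDeriv_pow (X : ℂ → ℂ) (a : ℕ) (z : ℂ) :
    fieldDeriv X (fun w => w ^ a) z = a * z ^ (a - 1) * X z := by
  have h := ((hasDerivAt_pow a z).hasFDerivAt.restrictScalars ℝ).fderiv
  rw [fieldDeriv, h]
  simp [mul_comm]

theorem fieldDeriv_conj_pow (X : ℂ → ℂ) (b : ℕ) (z : ℂ) :
    fieldDeriv X (fun w => starRingEnd ℂ w ^ b) z =
      b * starRingEnd ℂ z ^ (b - 1) * starRingEnd ℂ (X z) := by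
  have h := fieldDeriv_conj X (fun w => w ^ b) z
  simp only [map_pow, fieldDeriv_pow, map_mul, map_natCast] at h
  exact h

/-- The factor `a` absorbs the case `a = 0`, where the truncated exponent `a - 1` is wrong. -/
theorem natCast_mul_pow_pred_mul (a : ℕ) (z : ℂ) : (a : ℂ) * z ^ (a - 1) * z = a * z ^ a := by
  rcases a with _ | a
  · simp
  · simp [pow_succ]; ring

theorem differentiableAt_pow' (a : ℕ) (z : ℂ) : DifferentiableAt ℝ (fun w : ℂ => w ^ a) z :=
  (contDiff_pow (n := 1) a).contDiffAt.differentiableAt (by simp)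

theorem differentiableAt_conj_pow (b : ℕ) (z : ℂ) :
    DifferentiableAt ℝ (fun w : ℂ => starRingEnd ℂ w ^ b) z :=
  (contDiff_conj_pow (n := 1) b).contDiffAt.differentiableAt (by simp)

theorem angularDeriv_monomial (a b : ℕ) :
    angularDeriv (monomial a b) = fun z => Complex.I * (a - b) * monomial a b z := by
  funext z
  rw [angularDeriv_eq, show monomial a b = fun w => w ^ a * starRingEnd ℂ w ^ b from rfl,
    fieldDeriv_mul (differentiableAt_pow' a z) (differentiableAt_conj_pow b z), fieldDeriv_pow,
    fieldDeriv_conj_pow]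
  simp only [rot, map_mul, Complex.conj_I]
  linear_combination Complex.I * starRingEnd ℂ z ^ b * natCast_mul_pow_pred_mul a z -
    Complex.I * z ^ a * natCast_mul_pow_pred_mul b (starRingEnd ℂ z)

theorem radialDeriv_monomial (a b : ℕ) (z : ℂ) :
    radialDeriv (monomial a b) z = (a + b) * monomial a b z := by
  change fieldDeriv id (fun w => w ^ a * starRingEnd ℂ w ^ b) z = _
  rw [fieldDeriv_mul (differentiableAt_pow' a z) (differentiableAt_conj_pow b z), fieldDeriv_pow,
    fieldDeriv_conj_pow]
  simp only [id, monomial]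
  linear_combination starRingEnd ℂ z ^ b * natCast_mul_pow_pred_mul a z +
    z ^ a * natCast_mul_pow_pred_mul b (starRingEnd ℂ z)

theorem fieldDeriv_const_const_pow (v : ℂ) (a : ℕ) (z : ℂ) :
    fieldDeriv (fun _ => v) (fieldDeriv (fun _ => v) fun w => w ^ a) z =
      a * ((a - 1 : ℕ) * z ^ (a - 1 - 1)) * v ^ 2 := by
  have h : (fieldDeriv (fun _ => v) fun w : ℂ => w ^ a) = fun w => (a * v) * w ^ (a - 1) := by
    funext w; rw [fieldDeriv_pow]; ring
  rw [h, fieldDeriv_mul (differentiableAt_const _) (differentiableAt_pow' _ z), fieldDeriv_pow]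
  simp [fieldDeriv]
  ring

theorem fieldDeriv_const_const_conj_pow (v : ℂ) (b : ℕ) (z : ℂ) :
    fieldDeriv (fun _ => v) (fieldDeriv (fun _ => v) fun w => starRingEnd ℂ w ^ b) z =
      b * ((b - 1 : ℕ) * starRingEnd ℂ z ^ (b - 1 - 1)) * starRingEnd ℂ v ^ 2 := by
  have h : (fieldDeriv (fun _ => v) fun w : ℂ => starRingEnd ℂ w ^ b) =
      fun w => (b * starRingEnd ℂ v) * starRingEnd ℂ w ^ (b - 1) := by
    funext w; rw [fieldDeriv_conj_pow]; ring
  rw [h, fieldDeriv_mul (differentiableAt_const _) (differentiableAt_conj_pow _ z),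
    fieldDeriv_conj_pow]
  simp [fieldDeriv]
  ring

/-- This is `Δ = 4 ∂_z ∂_z̄`: between the directions `1` and `I` the pure second derivatives cancel
and the mixed ones add. Truncated exponents occur only with coefficient zero. -/
theorem laplacian_monomial (a b : ℕ) {z : ℂ} (hz : z ∈ disk) :
    Laplacian.laplacian (monomial a b) z = 4 * a * b * monomial (a - 1) (b - 1) z := by
  have h1 : ContDiffOn ℝ ∞ (fun z : ℂ => z ^ a) disk := (contDiff_pow a).contDiffOn
  have h2 : ContDiffOn ℝ ∞ (fun z : ℂ => starRingEnd ℂ z ^ b) disk :=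
    (contDiff_conj_pow b).contDiffOn
  rw [laplacian_eq_fieldDeriv (contDiff_monomial a b).contDiffOn hz,
    show monomial a b = fun w => w ^ a * starRingEnd ℂ w ^ b from rfl,
    fieldDeriv_fieldDeriv_mul contDiff_const h1 h2 hz,
    fieldDeriv_fieldDeriv_mul contDiff_const h1 h2 hz]
  simp only [fieldDeriv_const_const_pow, fieldDeriv_const_const_conj_pow, fieldDeriv_pow,
    fieldDeriv_conj_pow, monomial, Complex.conj_I, map_one]
  linear_combination (z ^ a * (b * ((b - 1 : ℕ) * starRingEnd ℂ z ^ (b - 1 - 1))) +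
    starRingEnd ℂ z ^ b * (a * ((a - 1 : ℕ) * z ^ (a - 1 - 1))) -
    2 * a * b * z ^ (a - 1) * starRingEnd ℂ z ^ (b - 1)) * Complex.I_sq

/-- With `x = 1 - z z̄`, the diagonal coefficient is `4ab + (2+2γ)(a+b) + (a-b)² + (γ+1)²`, a
perfect square. The only other term has lower degree, so the operator is triangular. -/
theorem keldyshOp_monomial (γ : ℝ) (a b : ℕ) {z : ℂ} (hz : z ∈ disk) :
    keldyshOp γ (monomial a b) z = ((a : ℂ) + b + γ + 1) ^ 2 * monomial a b z -
      4 * a * b * monomial (a - 1) (b - 1) z := by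
  have e1 : angularDeriv (angularDeriv (monomial a b)) z = -((a : ℂ) - b) ^ 2 * monomial a b z := by
    have h : angularDeriv (monomial a b) = (Complex.I * (a - b)) • monomial a b := by
      rw [angularDeriv_monomial]; rfl
    have h2 : angularDeriv ((Complex.I * ((a : ℂ) - b)) • monomial a b) z =
        (Complex.I * (a - b)) * angularDeriv (monomial a b) z := by
      rw [angularDeriv, fderiv_const_smul
        ((contDiff_monomial (n := 1) a b).contDiffAt.differentiableAt (by simp))]
      rfl
    rw [h, h2, angularDeriv_monomial]
    linear_combination ((a : ℂ) - b) ^ 2 * monomial a b z * Complex.I_sq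
  have e2 : (bdf z : ℂ) = 1 - z * starRingEnd ℂ z := by
    rw [Complex.mul_conj, bdf, Complex.normSq_eq_norm_sq]; push_cast; ring
  have e3 : (a : ℂ) * b * (z * starRingEnd ℂ z) * monomial (a - 1) (b - 1) z =
      a * b * monomial a b z := by
    simp only [monomial]
    linear_combination (b * starRingEnd ℂ z ^ (b - 1) * starRingEnd ℂ z) *
      natCast_mul_pow_pred_mul a z +
      a * z ^ a * natCast_mul_pow_pred_mul b (starRingEnd ℂ z)
  rw [keldyshOp, laplacian_monomial a b hz, radialDeriv_monomial, e1, e2]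
  linear_combination 4 * e3

theorem keldyshOp_zero (γ : ℝ) {z : ℂ} (hz : z ∈ disk) : keldyshOp γ 0 z = 0 := by
  have := keldyshOp_smul γ 0 (smoothInterior.zero_mem) hz
  simpa only [smul_zero, zero_smul, Pi.zero_apply] using this

/-- Adding a preimage `f` of the lower-order term to the monomial leaves the diagonal coefficient `c
= (a+b+γ+1)² + 1`, which is positive and can be divided out. -/
theorem keldyshOp_add_one_monomial_step (γ : ℝ) (a b : ℕ) {f : ℂ → ℂ} (hf : f ∈ polynomials)
    (h : ∀ z ∈ disk, keldyshOp γ f z + f z = 4 * a * b * monomial (a - 1) (b - 1) z) :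
    ∃ g ∈ polynomials, ∀ z ∈ disk, keldyshOp γ g z + g z = monomial a b z := by
  set c : ℂ := ((a : ℂ) + b + γ + 1) ^ 2 + 1 with hcdef
  have hc : c ≠ 0 := by
    have h1 : c = ((((a : ℝ) + b + γ + 1) ^ 2 + 1 : ℝ) : ℂ) := by rw [hcdef]; push_cast; ring
    rw [h1, Complex.ofReal_ne_zero]
    positivity
  have hm : monomial a b ∈ polynomials := Submodule.subset_span ⟨(a, b), rfl⟩
  have hsm := smoothClosed_le (polynomials_le_smoothClosed hm)
  have hsf := smoothClosed_le (polynomials_le_smoothClosed hf)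
  refine ⟨c⁻¹ • (monomial a b + f), polynomials.smul_mem _ (add_mem hm hf), fun z hz => ?_⟩
  rw [keldyshOp_smul γ _ (add_mem hsm hsf) hz, Pi.smul_apply, keldyshOp_add γ hsm hsf hz,
    Pi.add_apply, Pi.smul_apply, Pi.add_apply, keldyshOp_monomial γ a b hz, smul_eq_mul,
    smul_eq_mul]
  field_simp
  linear_combination h z hz

/-- `L_γ + 1` maps polynomials onto polynomials. -/
theorem exists_keldyshOp_add_eq_monomial (γ : ℝ) (a b : ℕ) :
    ∃ f ∈ polynomials, ∀ z ∈ disk, keldyshOp γ f z + f z = monomial a b z := by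
  -- For `a = 0` there is no lower term. In the successor step `b = 0` needs no separate treatment,
  -- since the preimage for `b - 1` is multiplied by `b`.
  induction a generalizing b with
  | zero =>
    exact keldyshOp_add_one_monomial_step γ 0 b polynomials.zero_mem fun z hz => by
      simp [keldyshOp_zero γ hz]
  | succ a ih =>
    obtain ⟨f, hf, hf'⟩ := ih (b - 1)
    refine keldyshOp_add_one_monomial_step γ (a + 1) b
      (polynomials.smul_mem (4 * ((a + 1 : ℕ) : ℂ) * b) hf) fun z hz => ?_
    rw [keldyshOp_smul γ _ (smoothClosed_le (polynomials_le_smoothClosed hf)) hz, Pi.smul_apply,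
      Pi.smul_apply, ← smul_add, hf' z hz, smul_eq_mul, Nat.add_sub_cancel]

theorem exists_keldyshOp_add_eq (γ : ℝ) {p : ℂ → ℂ} (hp : p ∈ polynomials) :
    ∃ f ∈ polynomials, ∀ z ∈ disk, keldyshOp γ f z + f z = p z := by
  induction hp using Submodule.span_induction with
  | mem p hp =>
    obtain ⟨⟨a, b⟩, rfl⟩ := hp
    exact exists_keldyshOp_add_eq_monomial γ a b
  | zero =>
    refine ⟨0, zero_mem _, fun z hz => ?_⟩
    rw [keldyshOp_zero γ hz, Pi.zero_apply, add_zero]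
  | add p q _ _ h1 h2 =>
    obtain ⟨f, hf, hf'⟩ := h1
    obtain ⟨g, hg, hg'⟩ := h2
    refine ⟨f + g, add_mem hf hg, fun z hz => ?_⟩
    rw [keldyshOp_add γ (smoothClosed_le (polynomials_le_smoothClosed hf))
      (smoothClosed_le (polynomials_le_smoothClosed hg)) hz, Pi.add_apply, Pi.add_apply,
      Pi.add_apply, ← hf' z hz, ← hg' z hz]
    ring
  | smul c p _ h =>
    obtain ⟨f, hf, hf'⟩ := h
    refine ⟨c • f, Submodule.smul_mem _ c hf, fun z hz => ?_⟩
    rw [keldyshOp_smul γ c (smoothClosed_le (polynomials_le_smoothClosed hf)) hz, Pi.smul_apply,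
      Pi.smul_apply, Pi.smul_apply, ← hf' z hz, smul_add]

/-! ### Density of polynomials -/

theorem mul_mem_polynomials {p q : ℂ → ℂ} (hp : p ∈ polynomials) (hq : q ∈ polynomials) :
    p * q ∈ polynomials := by
  have h : polynomials * polynomials ≤ polynomials := by
    rw [polynomials, Submodule.span_mul_span]
    refine Submodule.span_le.2 ?_
    rintro _ ⟨_, ⟨⟨a, b⟩, rfl⟩, _, ⟨⟨c, d⟩, rfl⟩, rfl⟩
    refine Submodule.subset_span ⟨(a + c, b + d), ?_⟩
    ext z
    simp only [monomial, Pi.mul_apply]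
    ring
  exact h (Submodule.mul_mem_mul hp hq)

theorem conj_mem_polynomials {p : ℂ → ℂ} (hp : p ∈ polynomials) :
    (fun z => starRingEnd ℂ (p z)) ∈ polynomials := by
  induction hp using Submodule.span_induction with
  | mem p hp =>
    obtain ⟨⟨a, b⟩, rfl⟩ := hp
    refine Submodule.subset_span ⟨(b, a), ?_⟩
    ext z
    simp [monomial, mul_comm]
  | zero =>
    convert polynomials.zero_mem using 1
    ext z
    simp
  | add p q _ _ h1 h2 =>
    convert add_mem h1 h2 using 1
    ext z
    simp
  | smul c p _ h =>
    convert polynomials.smul_mem (starRingEnd ℂ c) h using 1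
    ext z
    simp

theorem exists_polynomial_of_mem_starClosure {K : Set ℂ} {f : C(K, ℂ)}
    (hf : f ∈ (polynomialFunctions K).starClosure) : ∃ p ∈ polynomials, ∀ z : K, f z = p z := by
  rw [polynomialFunctions.starClosure_eq_adjoin_X] at hf
  induction hf using StarAlgebra.adjoin_induction with
  | mem f hf =>
    rw [mem_singleton_iff] at hf
    subst hf
    refine ⟨monomial 1 0, Submodule.subset_span ⟨(1, 0), rfl⟩, fun z => ?_⟩
    simp [monomial]
  | algebraMap c =>
    refine ⟨c • monomial 0 0, polynomials.smul_mem c (Submodule.subset_span ⟨(0, 0), rfl⟩),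
      fun z => ?_⟩
    simp [monomial]
  | add f g _ _ h1 h2 =>
    obtain ⟨p, hp, hp'⟩ := h1
    obtain ⟨q, hq, hq'⟩ := h2
    exact ⟨p + q, add_mem hp hq, fun z => by simp [hp', hq']⟩
  | mul f g _ _ h1 h2 =>
    obtain ⟨p, hp, hp'⟩ := h1
    obtain ⟨q, hq, hq'⟩ := h2
    exact ⟨p * q, mul_mem_polynomials hp hq, fun z => by simp [hp', hq']⟩
  | star f _ h =>
    obtain ⟨p, hp, hp'⟩ := h
    exact ⟨_, conj_mem_polynomials hp, fun z => by simp [hp']⟩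

/-- Stone–Weierstrass on the closed disk: the star algebra generated by the coordinate consists of
polynomials in `z` and `z̄`. -/
theorem exists_polynomial_near {g : ℂ → ℂ} (hg : Continuous g) {δ : ℝ} (hδ : 0 < δ) :
    ∃ p ∈ polynomials, ∀ z ∈ Metric.closedBall (0 : ℂ) 1, ‖g z - p z‖ ≤ δ := by
  set K := Metric.closedBall (0 : ℂ) 1
  have : CompactSpace K := isCompact_iff_compactSpace.1 (isCompact_closedBall 0 1)
  let G : C(K, ℂ) := ⟨fun z => g z, hg.comp continuous_subtype_val⟩
  have hG : G ∈ (polynomialFunctions K).starClosure.topologicalClosure := by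
    rw [polynomialFunctions.starClosure_topologicalClosure]; trivial
  obtain ⟨f, hf, hlt⟩ := Metric.mem_closure_iff.1 hG δ hδ
  obtain ⟨p, hp, hp'⟩ := exists_polynomial_of_mem_starClosure hf
  refine ⟨p, hp, fun z hz => ?_⟩
  have := (ContinuousMap.dist_apply_le_dist (f := G) (g := f) ⟨z, hz⟩).trans hlt.le
  rwa [hp', dist_eq_norm] at this

theorem bdf_le_one (z : ℂ) : bdf z ≤ 1 := by
  unfold bdf; nlinarith [sq_nonneg ‖z‖]

theorem isFiniteMeasure_diskMeasure {γ : ℝ} (hγ : 0 ≤ γ) : IsFiniteMeasure (diskMeasure γ) := by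
  refine ⟨?_⟩
  rw [← lintegral_one, lintegral_diskMeasure]
  refine (setLIntegral_mono measurable_const (g := fun _ => 1) fun z hz => ?_).trans_lt ?_
  · rw [mul_one, ENNReal.ofReal_le_one]
    exact Real.rpow_le_one (bdf_pos hz).le (bdf_le_one z) hγ
  · simp [disk]

/-- Polynomials are dense in `L²_γ`. -/
theorem exists_polynomial_eLpNorm_lt {γ : ℝ} (hγ : 0 ≤ γ) {h : ℂ → ℂ}
    (hh : MemLp h 2 (diskMeasure γ)) {ε : ℝ} (hε : 0 < ε) :
    ∃ p ∈ polynomials, eLpNorm (h - p) 2 (diskMeasure γ) < ENNReal.ofReal ε := by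
  have := isFiniteMeasure_diskMeasure hγ
  obtain ⟨g, -, hg1, hg2, hg3⟩ := hh.exists_hasCompactSupport_eLpNorm_sub_le (by simp)
    (ε := ENNReal.ofReal (ε / 3)) (by simpa using hε)
  set M : ℝ := ((diskMeasure γ univ) ^ (2 : ENNReal).toReal⁻¹).toReal with hM
  have hMt : (diskMeasure γ univ) ^ (2 : ENNReal).toReal⁻¹ = ENNReal.ofReal M := by
    rw [hM, ENNReal.ofReal_toReal]
    exact (ENNReal.rpow_lt_top_of_nonneg (by simp) (measure_ne_top _ _)).ne
  have hM0 : 0 ≤ M := ENNReal.toReal_nonneg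
  -- Here `M` is the `L²` norm of the constant `1`; dividing by `M + 1` makes the `L²` error at most
  -- `ε / 3` and avoids a zero denominator.
  obtain ⟨p, hp, hp'⟩ := exists_polynomial_near hg2 (δ := ε / 3 / (M + 1)) (by positivity)
  obtain ⟨p', hp'c, hpp'⟩ := polynomials_le_smoothClosed hp
  have hpm : AEStronglyMeasurable p (diskMeasure γ) :=
    hp'c.continuous.aestronglyMeasurable.congr (by
      filter_upwards [ae_mem_disk γ] with z hz using (hpp' (Metric.ball_subset_closedBall hz)).symm)
  have h2 : eLpNorm (g - p) 2 (diskMeasure γ) ≤ ENNReal.ofReal (ε / 3) := by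
    refine (eLpNorm_le_of_ae_bound (C := ε / 3 / (M + 1)) ?_).trans ?_
    · filter_upwards [ae_mem_disk γ] with z hz using hp' z (Metric.ball_subset_closedBall hz)
    · rw [hMt, ← ENNReal.ofReal_mul hM0]
      refine ENNReal.ofReal_le_ofReal ?_
      rw [mul_div_assoc', div_le_iff₀ (by positivity)]
      nlinarith
  refine ⟨p, hp, ?_⟩
  calc eLpNorm (h - p) 2 (diskMeasure γ) = eLpNorm ((h - g) + (g - p)) 2 (diskMeasure γ) := by
        rw [sub_add_sub_cancel]
    _ ≤ eLpNorm (h - g) 2 (diskMeasure γ) + eLpNorm (g - p) 2 (diskMeasure γ) :=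
        eLpNorm_add_le (hh.1.sub hg3.1) (hg3.1.sub hpm) (by norm_num)
    _ ≤ ENNReal.ofReal (ε / 3) + ENNReal.ofReal (ε / 3) := add_le_add hg1 h2
    _ = ENNReal.ofReal (ε / 3 + ε / 3) := (ENNReal.ofReal_add (by positivity) (by positivity)).symm
    _ < ENNReal.ofReal ε := (ENNReal.ofReal_lt_ofReal_iff hε).2 (by linarith)

/-! ### Logarithmic cutoffs -/

theorem deriv_smoothTransition_of_neg {t : ℝ} (ht : t < 0) : deriv Real.smoothTransition t = 0 := by
  have h : Real.smoothTransition =ᶠ[𝓝 t] fun _ => 0 := by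
    filter_upwards [Iio_mem_nhds ht] with s hs using Real.smoothTransition.zero_of_nonpos (le_of_lt hs)
  rw [h.deriv_eq, deriv_const]

theorem deriv_smoothTransition_of_one_lt {t : ℝ} (ht : 1 < t) :
    deriv Real.smoothTransition t = 0 := by
  have h : Real.smoothTransition =ᶠ[𝓝 t] fun _ => 1 := by
    filter_upwards [Ioi_mem_nhds ht] with s hs using Real.smoothTransition.one_of_one_le (le_of_lt hs)
  rw [h.deriv_eq, deriv_const]

theorem exists_bound_deriv_smoothTransition :
    ∃ C : ℝ, 0 ≤ C ∧ ∀ t, |deriv Real.smoothTransition t| ≤ C := by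
  have hc : Continuous (deriv Real.smoothTransition) :=
    (Real.smoothTransition.contDiff (n := 1)).continuous_deriv (by simp)
  obtain ⟨C, hC⟩ := (isCompact_Icc (a := (0 : ℝ)) (b := 1)).exists_bound_of_continuousOn
    hc.continuousOn
  have h0 : 0 ≤ C := (norm_nonneg _).trans (hC 0 (by simp))
  refine ⟨C, h0, fun t => ?_⟩
  rcases lt_or_ge t 0 with h | h
  · simpa [deriv_smoothTransition_of_neg h] using h0
  rcases lt_or_ge 1 t with h' | h'
  · simpa [deriv_smoothTransition_of_one_lt h'] using h0
  · exact hC t ⟨h, h'⟩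

/-- A cutoff to the interior of the disk, interpolating in `log x` between `x = exp (-2 (n + 1))`
and `x = exp (-(n + 1))`. -/
noncomputable def cutoff (n : ℕ) : ℂ → ℂ :=
  disk.indicator fun z =>
    ((Real.smoothTransition (Real.log (bdf z) / ((n : ℝ) + 1) + 2) : ℝ) : ℂ)

theorem cutoff_apply (n : ℕ) {z : ℂ} (hz : z ∈ disk) :
    cutoff n z = ((Real.smoothTransition (Real.log (bdf z) / ((n : ℝ) + 1) + 2) : ℝ) : ℂ) :=
  indicator_of_mem hz _

theorem mem_disk_of_bdf_pos {z : ℂ} (h : 0 < bdf z) : z ∈ disk := by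
  rw [disk, mem_ball_zero_iff]
  unfold bdf at h
  nlinarith [norm_nonneg z]

theorem continuous_bdf : Continuous bdf := contDiff_bdf (n := 0).continuous

theorem cutoff_arg_nonpos {n : ℕ} {z : ℂ} (hz : z ∈ disk)
    (h : bdf z < Real.exp (-(2 * ((n : ℝ) + 1)))) :
    Real.log (bdf z) / ((n : ℝ) + 1) + 2 < 0 := by
  have h1 : Real.log (bdf z) < -(2 * ((n : ℝ) + 1)) := (Real.log_lt_iff_lt_exp (bdf_pos hz)).2 h
  have h2 : (0 : ℝ) < (n : ℝ) + 1 := by positivity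
  have h3 : Real.log (bdf z) / ((n : ℝ) + 1) < -2 := by
    rw [div_lt_iff₀ h2]; linarith
  linarith

theorem cutoff_eq_zero {n : ℕ} {z : ℂ} (h : bdf z < Real.exp (-(2 * ((n : ℝ) + 1)))) :
    cutoff n z = 0 := by
  by_cases hz : z ∈ disk
  · rw [cutoff_apply n hz, Real.smoothTransition.zero_of_nonpos (cutoff_arg_nonpos hz h).le,
      Complex.ofReal_zero]
  · exact indicator_of_notMem hz _

theorem hasFDerivAt_cutoff (n : ℕ) {z : ℂ} (hz : z ∈ disk) :
    HasFDerivAt (cutoff n) (Complex.ofRealCLM.comp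
      ((deriv Real.smoothTransition (Real.log (bdf z) / ((n : ℝ) + 1) + 2)) •
        (((n : ℝ) + 1)⁻¹ • ((bdf z)⁻¹ •
          (-((2 * z.re) • Complex.reCLM + (2 * z.im) • Complex.imCLM)))))) z := by
  have h1 := (hasFDerivAt_bdf z).log (bdf_pos hz).ne'
  have h2 := (h1.mul_const ((n : ℝ) + 1)⁻¹).add_const 2
  have h3 : HasDerivAt Real.smoothTransition _ (Real.log (bdf z) * ((n : ℝ) + 1)⁻¹ + 2) :=
    ((Real.smoothTransition.contDiff (n := 1)).differentiable (by simp) _).hasDerivAt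
  have h4 := Complex.ofRealCLM.hasFDerivAt.comp z (h3.comp_hasFDerivAt z h2)
  refine (h4.congr_of_eventuallyEq ?_)
  filter_upwards [isOpen_disk.mem_nhds hz] with w hw
  rw [cutoff_apply n hw]
  rfl

theorem fieldDeriv_cutoff (X : ℂ → ℂ) (n : ℕ) {z : ℂ} (hz : z ∈ disk) :
    fieldDeriv X (cutoff n) z =
      ((-(deriv Real.smoothTransition (Real.log (bdf z) / ((n : ℝ) + 1) + 2) *
        (((n : ℝ) + 1)⁻¹ * ((bdf z)⁻¹ * (2 * (z.re * (X z).re + z.im * (X z).im))))) : ℝ) : ℂ) := by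
  rw [fieldDeriv, (hasFDerivAt_cutoff n hz).fderiv]
  simp
  ring

/-- The cutoffs are radial, so they never contribute to the angular part of the energy. -/
theorem fieldDeriv_rot_cutoff (n : ℕ) {z : ℂ} (hz : z ∈ disk) : fieldDeriv rot (cutoff n) z = 0 := by
  rw [fieldDeriv_cutoff rot n hz]
  have : z.re * (rot z).re + z.im * (rot z).im = 0 := by simp [rot]; ring
  rw [this]
  simp

theorem cutoff_mem_testFunctions (n : ℕ) : cutoff n ∈ testFunctions := by
  -- The cutoff vanishes off `K`. On `K` the function `x` is bounded below, so `K` is compact in the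
  -- open disk and `log x` is smooth near it.
  set K := {z : ℂ | Real.exp (-(2 * ((n : ℝ) + 1))) ≤ bdf z} with hK
  have hKc : IsClosed K := isClosed_le continuous_const continuous_bdf
  have hKd : K ⊆ disk := fun z hz => mem_disk_of_bdf_pos ((Real.exp_pos _).trans_le hz)
  have hKcpt : IsCompact K := (isCompact_closedBall (0 : ℂ) 1).of_isClosed_subset hKc
    (hKd.trans Metric.ball_subset_closedBall)
  have hts : tsupport (cutoff n) ⊆ K := by
    refine closure_minimal (fun z hz => ?_) hKc
    by_contra h
    exact hz (cutoff_eq_zero (not_le.1 h))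
  refine ⟨?_, hKcpt.of_isClosed_subset (isClosed_tsupport _) hts, hts.trans hKd⟩
  rw [contDiff_iff_contDiffAt]
  intro z
  by_cases hz : z ∈ K
  · have h1 : ContDiffAt ℝ ∞ (fun w => Real.log (bdf w) / ((n : ℝ) + 1) + 2) z :=
      ((contDiff_bdf.contDiffAt.log (bdf_pos (hKd hz)).ne').div_const _).add contDiffAt_const
    have h2 : ContDiffAt ℝ ∞ (fun w => ((Real.smoothTransition
        (Real.log (bdf w) / ((n : ℝ) + 1) + 2) : ℝ) : ℂ)) z :=
      Complex.ofRealCLM.contDiff.contDiffAt.comp z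
        ((Real.smoothTransition.contDiff (n := ⊤)).contDiffAt.comp z h1)
    refine h2.congr_of_eventuallyEq ?_
    filter_upwards [isOpen_disk.mem_nhds (hKd hz)] with w hw using cutoff_apply n hw
  · have h : cutoff n =ᶠ[𝓝 z] fun _ => 0 := by
      filter_upwards [hKc.isOpen_compl.mem_nhds hz] with w hw using cutoff_eq_zero (not_le.1 hw)
    exact contDiffAt_const.congr_of_eventuallyEq h

theorem norm_cutoff_le_one (n : ℕ) (z : ℂ) : ‖cutoff n z‖ ≤ 1 := by
  by_cases hz : z ∈ disk
  · rw [cutoff_apply n hz, Complex.norm_real, Real.norm_of_nonneg (Real.smoothTransition.nonneg _)]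
    exact Real.smoothTransition.le_one _
  · rw [cutoff, indicator_of_notMem hz]; simp

theorem norm_one_sub_cutoff_le_one (n : ℕ) {z : ℂ} (hz : z ∈ disk) : ‖1 - cutoff n z‖ ≤ 1 := by
  rw [cutoff_apply n hz, ← Complex.ofReal_one, ← Complex.ofReal_sub, Complex.norm_real,
    Real.norm_of_nonneg (sub_nonneg.2 (Real.smoothTransition.le_one _))]
  linarith [Real.smoothTransition.nonneg (Real.log (bdf z) / ((n : ℝ) + 1) + 2)]

theorem eventually_cutoff_eq_one {z : ℂ} (hz : z ∈ disk) : ∀ᶠ n in atTop, cutoff n z = 1 := by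
  filter_upwards [eventually_ge_atTop ⌈-Real.log (bdf z)⌉₊] with n hn
  have h1 : -Real.log (bdf z) ≤ (n : ℝ) := Nat.ceil_le.1 hn
  have h2 : (0 : ℝ) < (n : ℝ) + 1 := by positivity
  have h3 : -1 ≤ Real.log (bdf z) / ((n : ℝ) + 1) := by
    rw [le_div_iff₀ h2]; linarith
  rw [cutoff_apply n hz, Real.smoothTransition.one_of_one_le (by linarith), Complex.ofReal_one]

/-! ### Gradient bounds for the cutoffs -/

theorem norm_re_mul_add_im_mul_le {z v : ℂ} (hz : z ∈ disk) (hv : ‖v‖ ≤ 1) :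
    |z.re * v.re + z.im * v.im| ≤ 1 := by
  have hz' : ‖z‖ < 1 := by simpa [disk] using hz
  have h : z.re * v.re + z.im * v.im = (starRingEnd ℂ z * v).re := by simp
  rw [h]
  refine (Complex.abs_re_le_norm _).trans ?_
  rw [norm_mul, RCLike.norm_conj]
  exact mul_le_one₀ hz'.le (norm_nonneg _) hv

/-- The function `1 / x` cut off at `x = exp (-2 N)`. -/
noncomputable def truncInv (N : ℝ) (z : ℂ) : ℝ :=
  if Real.exp (-(2 * N)) ≤ bdf z then (bdf z)⁻¹ else 0

/-- Differentiating `log x` produces `1 / x`, which the factor `x` cancels. The bound is uniform in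
`n`, as dominated convergence requires. -/
theorem bdf_mul_norm_fieldDeriv_cutoff_le {C : ℝ} (hC : ∀ t, |deriv Real.smoothTransition t| ≤ C)
    {v : ℂ} (hv : ‖v‖ ≤ 1) (n : ℕ) {z : ℂ} (hz : z ∈ disk) :
    bdf z * ‖fieldDeriv (fun _ => v) (cutoff n) z‖ ≤ 2 * C := by
  have hx := bdf_pos hz
  have hC0 : 0 ≤ C := (abs_nonneg _).trans (hC 0)
  have hN : ((n : ℝ) + 1)⁻¹ ≤ 1 := inv_le_one_of_one_le₀ (by linarith [Nat.cast_nonneg (α := ℝ) n])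
  have hN0 : 0 ≤ ((n : ℝ) + 1)⁻¹ := by positivity
  rw [fieldDeriv_cutoff _ n hz, Complex.norm_real, Real.norm_eq_abs, abs_neg, abs_mul, abs_mul,
    abs_mul, abs_mul, abs_of_nonneg hN0, abs_of_pos (inv_pos.2 hx), abs_two]
  set d := |deriv Real.smoothTransition (Real.log (bdf z) / ((n : ℝ) + 1) + 2)|
  set r := |z.re * v.re + z.im * v.im|
  have hr : r ≤ 1 := norm_re_mul_add_im_mul_le hz hv
  have hr0 : 0 ≤ r := abs_nonneg _
  have e : bdf z * (d * (((n : ℝ) + 1)⁻¹ * ((bdf z)⁻¹ * (2 * r)))) =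
      2 * (d * (((n : ℝ) + 1)⁻¹ * r)) := by
    field_simp
  rw [e]
  have : d * (((n : ℝ) + 1)⁻¹ * r) ≤ C * (1 * 1) := by
    gcongr
    exact hC _
  linarith

/-- Squaring leaves one uncancelled `1 / x` together with `N^{-2}`, `N = n + 1`. The cutoff is
locally zero where `x < e^{-2N}`, so the truncated `1 / x` suffices. -/
theorem bdf_mul_norm_sq_fieldDeriv_cutoff_le {C : ℝ}
    (hC : ∀ t, |deriv Real.smoothTransition t| ≤ C) {v : ℂ} (hv : ‖v‖ ≤ 1) (n : ℕ) {z : ℂ}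
    (hz : z ∈ disk) :
    bdf z * ‖fieldDeriv (fun _ => v) (cutoff n) z‖ ^ 2 ≤
      4 * C ^ 2 * (((n : ℝ) + 1)⁻¹) ^ 2 * truncInv ((n : ℝ) + 1) z := by
  have hx := bdf_pos hz
  have hC0 : 0 ≤ C := (abs_nonneg _).trans (hC 0)
  have hN0 : 0 ≤ ((n : ℝ) + 1)⁻¹ := by positivity
  rw [fieldDeriv_cutoff _ n hz, Complex.norm_real, Real.norm_eq_abs, abs_neg, abs_mul, abs_mul,
    abs_mul, abs_mul, abs_of_nonneg hN0, abs_of_pos (inv_pos.2 hx), abs_two, truncInv]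
  split_ifs with h
  · set d := |deriv Real.smoothTransition (Real.log (bdf z) / ((n : ℝ) + 1) + 2)|
    set r := |z.re * v.re + z.im * v.im|
    have hr : r ≤ 1 := norm_re_mul_add_im_mul_le hz hv
    have hr0 : 0 ≤ r := abs_nonneg _
    have e : bdf z * (d * (((n : ℝ) + 1)⁻¹ * ((bdf z)⁻¹ * (2 * r)))) ^ 2 =
        4 * (d ^ 2 * r ^ 2) * (((n : ℝ) + 1)⁻¹) ^ 2 * (bdf z)⁻¹ := by
      field_simp; ring
    rw [e]
    have h2 : d ^ 2 * r ^ 2 ≤ C ^ 2 * 1 ^ 2 := by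
      gcongr
      exact hC _
    rw [one_pow, mul_one] at h2
    gcongr
  · rw [deriv_smoothTransition_of_neg (cutoff_arg_nonpos hz (not_le.1 h))]
    simp

theorem measurable_truncInv (N : ℝ) : Measurable (truncInv N) :=
  Measurable.ite (measurableSet_le measurable_const measurable_bdf) measurable_bdf.inv
    measurable_const

theorem truncInv_nonneg (N : ℝ) (z : ℂ) : 0 ≤ truncInv N z := by
  unfold truncInv
  split_ifs with h
  · exact inv_nonneg.2 ((Real.exp_pos _).le.trans h)
  · exact le_rfl

theorem truncInv_le (N : ℝ) (z : ℂ) : truncInv N z ≤ Real.exp (2 * N) := by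
  unfold truncInv
  split_ifs with h
  · rw [← neg_neg (2 * N), Real.exp_neg]
    exact inv_anti₀ (Real.exp_pos _) h
  · exact (Real.exp_pos _).le

theorem integrableOn_of_bounded {E : Type*} [NormedAddCommGroup E] {F : ℂ → E} {M : ℝ}
    (hF : AEStronglyMeasurable F (volume.restrict disk)) (hM : ∀ z ∈ disk, ‖F z‖ ≤ M) :
    IntegrableOn F disk :=
  IntegrableOn.of_bound (by simp [disk]) hF M ((ae_restrict_mem isOpen_disk.measurableSet).mono hM)

theorem integrableOn_truncInv (N : ℝ) : IntegrableOn (truncInv N) disk := by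
  refine integrableOn_of_bounded (M := Real.exp (2 * N))
    (measurable_truncInv N).aestronglyMeasurable fun z _ => ?_
  rw [Real.norm_of_nonneg (truncInv_nonneg N z)]
  exact truncInv_le N z

/-- In polar coordinates this is `2π ∫_0^R ρ / (1 - ρ²) dρ = -π log(1 - R²)` with `1 - R² =
e^{-2N}`. Growth only linear in `N` is what the factor `N^{-2}` in the gradient bound overcomes. -/
theorem integral_truncInv {N : ℝ} (hN : 0 < N) :
    ∫ z in disk, truncInv N z = 2 * Real.pi * N := by
  have h0 : ∫ z in disk, truncInv N z = ∫ z, truncInv N z := by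
    refine setIntegral_eq_integral_of_forall_compl_eq_zero fun z hz => ?_
    rw [truncInv, if_neg fun h => hz (mem_disk_of_bdf_pos ((Real.exp_pos _).trans_le h))]
  set φ : ℝ → ℝ := fun r => if Real.exp (-(2 * N)) ≤ 1 - r ^ 2 then (1 - r ^ 2)⁻¹ else 0 with hφ
  have h1 : ∫ z, truncInv N z = ∫ z : ℂ, φ ‖z‖ := rfl
  set R := √(1 - Real.exp (-(2 * N))) with hR
  have hexp : Real.exp (-(2 * N)) < 1 := Real.exp_lt_one_iff.2 (by linarith)
  have hR2 : R ^ 2 = 1 - Real.exp (-(2 * N)) := Real.sq_sqrt (by linarith)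
  have hR0 : 0 ≤ R := Real.sqrt_nonneg _
  have h2 : ∫ y in Ioi (0 : ℝ), y ^ (2 - 1) • φ y = ∫ y in (0 : ℝ)..R, y * (1 - y ^ 2)⁻¹ := by
    rw [intervalIntegral.integral_of_le hR0, ← integral_indicator measurableSet_Ioi,
      ← integral_indicator measurableSet_Ioc]
    refine integral_congr_ae (Eventually.of_forall fun y => ?_)
    simp only [indicator, mem_Ioi, mem_Ioc, hφ]
    by_cases hy : 0 < y
    · have : Real.exp (-(2 * N)) ≤ 1 - y ^ 2 ↔ y ≤ R := by
        rw [← abs_of_pos hy, ← abs_of_nonneg hR0, ← sq_le_sq, hR2, sq_abs]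
        constructor <;> intro h <;> linarith
      simp [hy, this]
    · simp [hy]
  have h3 : ∫ y in (0 : ℝ)..R, y * (1 - y ^ 2)⁻¹ = N := by
    have hpos : ∀ y ∈ uIcc 0 R, 0 < 1 - y ^ 2 := fun y hy => by
      rw [uIcc_of_le hR0] at hy
      have : y ^ 2 ≤ R ^ 2 := pow_le_pow_left₀ hy.1 hy.2 2
      have := Real.exp_pos (-(2 * N))
      linarith
    rw [intervalIntegral.integral_eq_sub_of_hasDerivAt (f := fun y => -(Real.log (1 - y ^ 2) / 2))]
    · rw [hR2]; simp; ring
    · intro y hy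
      have := ((((hasDerivAt_pow 2 y).const_sub 1).log (hpos y hy).ne').div_const 2).neg
      refine this.congr_deriv ?_
      simp
      ring
    · refine ContinuousOn.intervalIntegrable ?_
      exact continuousOn_id.mul ((continuousOn_const.sub (continuousOn_id.pow 2)).inv₀ fun y hy =>
        (hpos y hy).ne')
  rw [h0, h1, integral_fun_norm_addHaar, Complex.finrank_real_complex, h2, h3]
  simp [Measure.real, mul_assoc]

/-! ### The form of `L_γ` on functions smooth up to the boundary -/

theorem exists_bound_on_disk {F : ℂ → ℂ} (hF : Continuous F) :
    ∃ M : ℝ, 0 ≤ M ∧ ∀ z ∈ disk, ‖F z‖ ≤ M := by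
  obtain ⟨M, hM⟩ := (isCompact_closedBall (0 : ℂ) 1).exists_bound_of_continuousOn hF.continuousOn
  exact ⟨M, (norm_nonneg _).trans (hM 0 (by simp)),
    fun z hz => hM z (Metric.ball_subset_closedBall hz)⟩

theorem contDiff_fieldDeriv {X f : ℂ → ℂ} (hX : ContDiff ℝ ∞ X) (hf : ContDiff ℝ ∞ f) :
    ContDiff ℝ ∞ (fieldDeriv X f) :=
  (hf.fderiv_right (m := ∞) (by simp)).clm_apply hX

theorem contDiff_one_field : ContDiff ℝ ∞ fun _ : ℂ => (1 : ℂ) := contDiff_const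

theorem contDiff_I_field : ContDiff ℝ ∞ fun _ : ℂ => Complex.I := contDiff_const

/-- The coordinate formula for `L_γ f` has coefficients continuous on the whole plane; this yields
boundedness of `L_γ f` on the disk. -/
theorem exists_continuous_eqOn_keldyshOp (γ : ℝ) {f : ℂ → ℂ} (hf : ContDiff ℝ ∞ f) :
    ∃ G : ℂ → ℂ, Continuous G ∧ EqOn (keldyshOp γ f) G disk := by
  refine ⟨_, ?_, fun z hz => keldyshOp_eq_fieldDeriv γ hf.contDiffOn hz⟩
  have h1 := (contDiff_fieldDeriv contDiff_one_field hf)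
  have h2 := (contDiff_fieldDeriv contDiff_I_field hf)
  have c1 := h1.continuous
  have c2 := h2.continuous
  have c11 := (contDiff_fieldDeriv contDiff_one_field h1).continuous
  have c22 := (contDiff_fieldDeriv contDiff_I_field h2).continuous
  have c33 := (contDiff_fieldDeriv contDiff_rot (contDiff_fieldDeriv contDiff_rot hf)).continuous
  have cb := continuous_bdf
  have cf := hf.continuous
  fun_prop

theorem norm_bdfPow_le_one {γ : ℝ} (hγ : 0 ≤ γ) {z : ℂ} (hz : z ∈ disk) : ‖bdfPow γ z‖ ≤ 1 := by
  rw [bdfPow, Complex.norm_real, Real.norm_of_nonneg (Real.rpow_nonneg (bdf_pos hz).le _)]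
  exact Real.rpow_le_one (bdf_pos hz).le (bdf_le_one z) hγ

theorem energy_congr (γ : ℝ) {f f' h h' : ℂ → ℂ} (hf : EqOn f f' disk) (hh : EqOn h h' disk) :
    EqOn (energy γ f h) (energy γ f' h') disk := fun z hz => by
  simp only [energy, fieldDeriv_congr hf hz, fieldDeriv_congr hh hz, hf hz, hh hz]

theorem energy_contDiffOn (γ : ℝ) {f h : ℂ → ℂ} (hf : ContDiffOn ℝ ∞ f disk)
    (hh : ContDiffOn ℝ ∞ h disk) : ContDiffOn ℝ ∞ (energy γ f h) disk := by
  have a1 := fieldDeriv_contDiffOn contDiff_one_field hf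
  have a2 := fieldDeriv_contDiffOn contDiff_I_field hf
  have a3 := fieldDeriv_contDiffOn contDiff_rot hf
  have b1 := fieldDeriv_contDiffOn contDiff_one_field hh
  have b2 := fieldDeriv_contDiffOn contDiff_I_field hh
  have b3 := fieldDeriv_contDiffOn contDiff_rot hh
  exact ((bdfPow_contDiffOn (γ + 1)).mul ((a1.mul b1).add (a2.mul b2))).add
    ((bdfPow_contDiffOn γ).mul ((a3.mul b3).add (contDiffOn_const.mul (hf.mul hh))))

theorem keldyshOp_continuousOn (γ : ℝ) {f : ℂ → ℂ} (hf : ContDiff ℝ ∞ f) :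
    ContinuousOn (keldyshOp γ f) disk := by
  obtain ⟨G, hG, hGf⟩ := exists_continuous_eqOn_keldyshOp γ hf
  exact hG.continuousOn.congr hGf

/-- For `γ ≥ 0` the weights `x^γ` and `x^{γ+1}` are at most `1`, and the remaining factors are
continuous on the closed disk. -/
theorem exists_bound_energy {γ : ℝ} (hγ : 0 ≤ γ) {f h : ℂ → ℂ} (hf : ContDiff ℝ ∞ f)
    (hh : ContDiff ℝ ∞ h) : ∃ M : ℝ, ∀ z ∈ disk, ‖energy γ f h z‖ ≤ M := by
  have a1 := (contDiff_fieldDeriv contDiff_one_field hf).continuous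
  have a2 := (contDiff_fieldDeriv contDiff_I_field hf).continuous
  have a3 := (contDiff_fieldDeriv contDiff_rot hf).continuous
  have b1 := (contDiff_fieldDeriv contDiff_one_field hh).continuous
  have b2 := (contDiff_fieldDeriv contDiff_I_field hh).continuous
  have b3 := (contDiff_fieldDeriv contDiff_rot hh).continuous
  obtain ⟨M, -, hM⟩ := exists_bound_on_disk ((a1.mul b1).add (a2.mul b2))
  obtain ⟨M', -, hM'⟩ := exists_bound_on_disk ((a3.mul b3).add
    ((continuous_const (y := ((γ : ℂ) + 1) ^ 2)).mul (hf.continuous.mul hh.continuous)))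
  refine ⟨1 * M + 1 * M', fun z hz => (norm_add_le _ _).trans (add_le_add ?_ ?_)⟩
  · rw [norm_mul]
    exact mul_le_mul (norm_bdfPow_le_one (by linarith) hz) (hM z hz) (norm_nonneg _) zero_le_one
  · rw [norm_mul]
    exact mul_le_mul (norm_bdfPow_le_one hγ hz) (hM' z hz) (norm_nonneg _) zero_le_one

theorem eventually_fieldDeriv_cutoff_eq_zero (X : ℂ → ℂ) {z : ℂ} (hz : z ∈ disk) :
    ∀ᶠ n in atTop, fieldDeriv X (cutoff n) z = 0 := by
  filter_upwards [eventually_ge_atTop ⌈-Real.log (bdf z)⌉₊] with n hn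
  have h1 : -Real.log (bdf z) ≤ (n : ℝ) := Nat.ceil_le.1 hn
  have h2 : (0 : ℝ) < (n : ℝ) + 1 := by positivity
  have h3 : -1 < Real.log (bdf z) / ((n : ℝ) + 1) := by
    rw [lt_div_iff₀ h2]; linarith
  rw [fieldDeriv_cutoff X n hz, deriv_smoothTransition_of_one_lt (by linarith)]
  simp

/-- Splitting `x^{γ+1} = x^γ x` attaches a factor `x` to each derivative of the cutoff, in the
combination that is bounded uniformly in `n`. -/
theorem energy_mul_cutoff (γ : ℝ) (f : ℂ → ℂ) {h : ℂ → ℂ} (hh : ContDiff ℝ ∞ h) (n : ℕ) {z : ℂ}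
    (hz : z ∈ disk) :
    energy γ f (fun w => h w * cutoff n w) z = cutoff n z * energy γ f h z +
      bdfPow γ z * (h z * (fieldDeriv (fun _ => 1) f z *
        (bdf z * fieldDeriv (fun _ => 1) (cutoff n) z) + fieldDeriv (fun _ => Complex.I) f z *
        (bdf z * fieldDeriv (fun _ => Complex.I) (cutoff n) z))) := by
  have dh := differentiableAt_of_disk hh.contDiffOn hz
  have dc := differentiableAt_of_disk (testFunctions_le (cutoff_mem_testFunctions n)) hz
  simp only [energy, fieldDeriv_mul dh dc, fieldDeriv_rot_cutoff n hz, bdfPow_add hz γ 1,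
    bdfPow_one]
  ring

/-- Integration by parts up to the boundary. -/
theorem integral_keldyshOp_mul {γ : ℝ} (hγ : 0 ≤ γ) {f h : ℂ → ℂ} (hf : ContDiff ℝ ∞ f)
    (hh : ContDiff ℝ ∞ h) :
    ∫ z in disk, bdfPow γ z * (keldyshOp γ f z * h z) = ∫ z in disk, energy γ f h z := by
  have hms := isOpen_disk.measurableSet
  have htest : ∀ n, (fun w => h w * cutoff n w) ∈ testFunctions := fun n =>
    mul_mem_testFunctions hh.contDiffOn (cutoff_mem_testFunctions n)
  have hcont : ∀ n, ContinuousOn (cutoff n) disk := fun n =>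
    (cutoff_mem_testFunctions n).1.continuous.continuousOn
  obtain ⟨G, hG, hGf⟩ := exists_continuous_eqOn_keldyshOp γ hf
  obtain ⟨MG, hMG0, hMG⟩ := exists_bound_on_disk hG
  obtain ⟨Mh, hMh0, hMh⟩ := exists_bound_on_disk hh.continuous
  obtain ⟨M1, hM10, hM1⟩ := exists_bound_on_disk
    (contDiff_fieldDeriv contDiff_one_field hf).continuous
  obtain ⟨M2, hM20, hM2⟩ := exists_bound_on_disk
    (contDiff_fieldDeriv contDiff_I_field hf).continuous
  obtain ⟨ME, hME⟩ := exists_bound_energy hγ hf hh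
  obtain ⟨C, hC0, hC⟩ := exists_bound_deriv_smoothTransition
  have hconst : ∀ M : ℝ, Integrable (fun _ : ℂ => M) (volume.restrict disk) := fun M =>
    integrableOn_of_bounded (M := ‖M‖) aestronglyMeasurable_const fun _ _ => le_rfl
  have lim1 : Tendsto (fun n => ∫ z in disk, bdfPow γ z * (keldyshOp γ f z * (h z * cutoff n z)))
      atTop (𝓝 (∫ z in disk, bdfPow γ z * (keldyshOp γ f z * h z))) := by
    refine tendsto_integral_of_dominated_convergence (fun _ => 1 * (MG * (Mh * 1))) (fun n => ?_)
      (hconst _) (fun n => ?_) ?_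
    · exact (((bdfPow_contDiffOn γ).continuousOn).mul ((keldyshOp_continuousOn γ hf).mul
        (hh.continuous.continuousOn.mul (hcont n)))).aestronglyMeasurable hms
    · filter_upwards [ae_restrict_mem hms] with z hz
      rw [norm_mul, norm_mul, norm_mul, hGf hz]
      gcongr
      exacts [norm_bdfPow_le_one hγ hz, hMG z hz, hMh z hz, norm_cutoff_le_one n z]
    · filter_upwards [ae_restrict_mem hms] with z hz
      refine tendsto_const_nhds.congr' ?_
      filter_upwards [eventually_cutoff_eq_one hz] with n hn
      rw [hn, mul_one]
  -- The terms with a differentiated cutoff are uniformly bounded and eventually zero at each point,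
  -- so dominated convergence removes them without any rate.
  have lim2 : Tendsto (fun n => ∫ z in disk, energy γ f (fun w => h w * cutoff n w) z)
      atTop (𝓝 (∫ z in disk, energy γ f h z)) := by
    refine tendsto_integral_of_dominated_convergence
      (fun _ => 1 * ME + 1 * (Mh * (M1 * (2 * C) + M2 * (2 * C)))) (fun n => ?_)
      (hconst _) (fun n => ?_) ?_
    · exact (energy_contDiffOn γ hf.contDiffOn
        (testFunctions_le (htest n))).continuousOn.aestronglyMeasurable hms
    · filter_upwards [ae_restrict_mem hms] with z hz
      rw [energy_mul_cutoff γ f hh n hz]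
      have hb : ∀ v : ℂ, ‖v‖ ≤ 1 → ‖(bdf z : ℂ) * fieldDeriv (fun _ => v) (cutoff n) z‖ ≤ 2 * C :=
        fun v hv => by
          rw [norm_mul, Complex.norm_real, Real.norm_of_nonneg (bdf_pos hz).le]
          exact bdf_mul_norm_fieldDeriv_cutoff_le hC hv n hz
      refine (norm_add_le _ _).trans (add_le_add ?_ ?_)
      · rw [norm_mul]
        exact mul_le_mul (norm_cutoff_le_one n z) (hME z hz) (norm_nonneg _) zero_le_one
      · rw [norm_mul, norm_mul]
        gcongr
        · exact norm_bdfPow_le_one hγ hz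
        · exact hMh z hz
        · refine (norm_add_le _ _).trans (add_le_add ?_ ?_)
          · rw [norm_mul]
            exact mul_le_mul (hM1 z hz) (hb 1 (by simp)) (norm_nonneg _) hM10
          · rw [norm_mul]
            exact mul_le_mul (hM2 z hz) (hb Complex.I (by simp)) (norm_nonneg _) hM20
    · filter_upwards [ae_restrict_mem hms] with z hz
      refine tendsto_const_nhds.congr' ?_
      filter_upwards [eventually_cutoff_eq_one hz,
        eventually_fieldDeriv_cutoff_eq_zero (fun _ => 1) hz,
        eventually_fieldDeriv_cutoff_eq_zero (fun _ => Complex.I) hz] with n h1 h2 h3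
      rw [energy_mul_cutoff γ f hh n hz, h1, h2, h3]
      ring
  refine tendsto_nhds_unique lim1 (lim2.congr fun n => ?_)
  exact (integral_keldyshOp_mul_testFunction γ hf.contDiffOn (htest n)).symm

theorem contDiff_conj_comp {f : ℂ → ℂ} (hf : ContDiff ℝ ∞ f) :
    ContDiff ℝ ∞ fun z => starRingEnd ℂ (f z) :=
  Complex.conjCLE.contDiff.comp hf

theorem integral_conj_mul_keldyshOp {γ : ℝ} (hγ : 0 ≤ γ) {f g : ℂ → ℂ} (hf : f ∈ smoothClosed)
    (hg : g ∈ smoothClosed) :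
    ∫ z, starRingEnd ℂ (g z) * keldyshOp γ f z ∂(diskMeasure γ) =
      ∫ z in disk, energy γ f (fun w => starRingEnd ℂ (g w)) z := by
  obtain ⟨f', hf', hff'⟩ := hf
  obtain ⟨g', hg', hgg'⟩ := hg
  have ef : EqOn f f' disk := hff'.mono Metric.ball_subset_closedBall
  have eg : EqOn g g' disk := hgg'.mono Metric.ball_subset_closedBall
  have eg' : EqOn (fun w => starRingEnd ℂ (g w)) (fun w => starRingEnd ℂ (g' w)) disk :=
    fun z hz => by simp only [eg hz]
  rw [integral_diskMeasure, setIntegral_congr_fun isOpen_disk.measurableSet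
    (energy_congr γ ef eg'), ← integral_keldyshOp_mul hγ hf' (contDiff_conj_comp hg')]
  refine setIntegral_congr_fun isOpen_disk.measurableSet fun z hz => ?_
  simp only [keldyshOp_congr γ ef hz, eg hz]
  ring

/-- The weights are real, so the form is Hermitian; this is the source of the symmetry of `L_γ`. -/
theorem conj_energy (γ : ℝ) (f g : ℂ → ℂ) (z : ℂ) :
    starRingEnd ℂ (energy γ f (fun w => starRingEnd ℂ (g w)) z) =
      energy γ g (fun w => starRingEnd ℂ (f w)) z := by
  simp only [energy, fieldDeriv_conj, map_add, map_mul, map_pow, Complex.conj_conj, bdfPow,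
    Complex.conj_ofReal, map_one]
  ring

/-- The energy density of a single function. -/
noncomputable def normEnergy (γ : ℝ) (f : ℂ → ℂ) (z : ℂ) : ℝ :=
  bdf z ^ (γ + 1) * (‖fieldDeriv (fun _ => 1) f z‖ ^ 2 +
    ‖fieldDeriv (fun _ => Complex.I) f z‖ ^ 2) +
  bdf z ^ γ * (‖fieldDeriv rot f z‖ ^ 2 + (γ + 1) ^ 2 * ‖f z‖ ^ 2)

theorem energy_conj_self (γ : ℝ) (f : ℂ → ℂ) (z : ℂ) :
    energy γ f (fun w => starRingEnd ℂ (f w)) z = (normEnergy γ f z : ℂ) := by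
  simp only [energy, normEnergy, fieldDeriv_conj, Complex.mul_conj, Complex.normSq_eq_norm_sq,
    bdfPow]
  push_cast
  ring

theorem normEnergy_nonneg (γ : ℝ) (f : ℂ → ℂ) {z : ℂ} (hz : z ∈ disk) : 0 ≤ normEnergy γ f z := by
  have := bdf_pos hz
  unfold normEnergy
  positivity

theorem re_integral_conj_mul_keldyshOp {γ : ℝ} (hγ : 0 ≤ γ) {f : ℂ → ℂ} (hf : f ∈ smoothClosed) :
    (∫ z, starRingEnd ℂ (f z) * keldyshOp γ f z ∂(diskMeasure γ)).re =
      ∫ z in disk, normEnergy γ f z := by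
  rw [integral_conj_mul_keldyshOp hγ hf hf]
  simp only [energy_conj_self]
  rw [integral_complex_ofReal, Complex.ofReal_re]

theorem memLp_of_continuousOn_of_bounded {γ : ℝ} (hγ : 0 ≤ γ) {f : ℂ → ℂ} (hf : ContinuousOn f disk)
    {M : ℝ} (hM : ∀ z ∈ disk, ‖f z‖ ≤ M) : MemLp f 2 (diskMeasure γ) := by
  have := isFiniteMeasure_diskMeasure hγ
  refine MemLp.of_bound ((hf.aestronglyMeasurable isOpen_disk.measurableSet).mono_ac
    (withDensity_absolutelyContinuous _ _)) M ?_
  filter_upwards [ae_mem_disk γ] with z hz using hM z hz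

theorem memLp_smoothClosed {γ : ℝ} (hγ : 0 ≤ γ) {f : ℂ → ℂ} (hf : f ∈ smoothClosed) :
    MemLp f 2 (diskMeasure γ) ∧ MemLp (keldyshOp γ f) 2 (diskMeasure γ) := by
  obtain ⟨f', hf', hff'⟩ := hf
  have ef : EqOn f f' disk := hff'.mono Metric.ball_subset_closedBall
  obtain ⟨G, hG, hGf⟩ := exists_continuous_eqOn_keldyshOp γ hf'
  obtain ⟨M, -, hM⟩ := exists_bound_on_disk hf'.continuous
  obtain ⟨MG, -, hMG⟩ := exists_bound_on_disk hG
  have eG : EqOn (keldyshOp γ f) G disk := (keldyshOp_congr γ ef).trans hGf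
  exact ⟨memLp_of_continuousOn_of_bounded hγ (hf'.continuous.continuousOn.congr ef)
      fun z hz => by rw [ef hz]; exact hM z hz,
    memLp_of_continuousOn_of_bounded hγ (hG.continuousOn.congr eG)
      fun z hz => by rw [eG hz]; exact hMG z hz⟩

/-! ### Approximation by test functions in the form norm -/

theorem tendsto_integral_one_sub_cutoff :
    Tendsto (fun n => ∫ z in disk, ‖1 - cutoff n z‖ ^ 2) atTop (𝓝 0) := by
  have h : Tendsto (fun n => ∫ z in disk, ‖1 - cutoff n z‖ ^ 2) atTop
      (𝓝 (∫ z in disk, (0 : ℝ))) := by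
    refine tendsto_integral_of_dominated_convergence (fun _ => 1) (fun n => ?_)
      (integrableOn_of_bounded (M := 1) aestronglyMeasurable_const fun _ _ => by simp)
      (fun n => ?_) ?_
    · exact ((continuous_const.sub
        (cutoff_mem_testFunctions n).1.continuous).norm.pow 2).aestronglyMeasurable
    · filter_upwards [ae_restrict_mem isOpen_disk.measurableSet] with z hz
      rw [Real.norm_of_nonneg (by positivity)]
      exact pow_le_one₀ (norm_nonneg _) (norm_one_sub_cutoff_le_one n hz)
    · filter_upwards [ae_restrict_mem isOpen_disk.measurableSet] with z hz
      refine tendsto_const_nhds.congr' ?_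
      filter_upwards [eventually_cutoff_eq_one hz] with n hn
      simp [hn]
  simpa using h

theorem fieldDeriv_one_sub_cutoff_mul (X : ℂ → ℂ) {f : ℂ → ℂ} (hf : ContDiff ℝ ∞ f) (n : ℕ) {z : ℂ}
    (hz : z ∈ disk) :
    fieldDeriv X (fun w => (1 - cutoff n w) * f w) z =
      (1 - cutoff n z) * fieldDeriv X f z - f z * fieldDeriv X (cutoff n) z := by
  have dh := differentiableAt_of_disk hf.contDiffOn hz
  have dc := differentiableAt_of_disk (testFunctions_le (cutoff_mem_testFunctions n)) hz
  have e : fieldDeriv X (fun w => 1 - cutoff n w) z = -fieldDeriv X (cutoff n) z := by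
    simp [fieldDeriv, fderiv_const_sub]
  rw [fieldDeriv_mul (dc.const_sub 1) dh, e]
  ring

theorem norm_sub_sq_le (a b : ℂ) : ‖a - b‖ ^ 2 ≤ 2 * ‖a‖ ^ 2 + 2 * ‖b‖ ^ 2 := by
  have h := norm_sub_le a b
  nlinarith [norm_nonneg (a - b), norm_nonneg a, norm_nonneg b, sq_nonneg (‖a‖ - ‖b‖)]

/-- By Leibniz, the gradient of `(1 - χ) f` splits into `(1 - χ) ∇f` and `-f ∇χ`. The first part and
the terms without gradient of the cutoff go into `K`; the second is controlled by the truncated `1 /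
x`. -/
theorem exists_normEnergy_one_sub_cutoff_mul_le {γ : ℝ} (hγ : 0 ≤ γ) {f : ℂ → ℂ}
    (hf : ContDiff ℝ ∞ f) :
    ∃ K K' : ℝ, ∀ n : ℕ, ∀ z ∈ disk, normEnergy γ (fun w => (1 - cutoff n w) * f w) z ≤
      K * ‖1 - cutoff n z‖ ^ 2 + K' * (((n : ℝ) + 1)⁻¹) ^ 2 * truncInv ((n : ℝ) + 1) z := by
  obtain ⟨M0, hM00, hM0⟩ := exists_bound_on_disk hf.continuous
  obtain ⟨M1, hM10, hM1⟩ := exists_bound_on_disk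
    (contDiff_fieldDeriv contDiff_one_field hf).continuous
  obtain ⟨M2, hM20, hM2⟩ := exists_bound_on_disk
    (contDiff_fieldDeriv contDiff_I_field hf).continuous
  obtain ⟨M3, hM30, hM3⟩ := exists_bound_on_disk
    (contDiff_fieldDeriv contDiff_rot hf).continuous
  obtain ⟨C, hC0, hC⟩ := exists_bound_deriv_smoothTransition
  -- Each of the two coordinate directions contributes `2 · 4 M0² C²` to the second constant: the
  -- `2` comes from `norm_sub_sq_le`, the `4 C²` from the squared gradient bound.
  refine ⟨2 * M1 ^ 2 + 2 * M2 ^ 2 + M3 ^ 2 + (γ + 1) ^ 2 * M0 ^ 2, 16 * M0 ^ 2 * C ^ 2,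
    fun n z hz => ?_⟩
  have hx := bdf_pos hz
  set w := ‖1 - cutoff n z‖ with hw
  set T := (((n : ℝ) + 1)⁻¹) ^ 2 * truncInv ((n : ℝ) + 1) z with hT
  have hγ1 : bdf z ^ γ ≤ 1 := Real.rpow_le_one hx.le (bdf_le_one z) hγ
  have hγ0 : 0 ≤ bdf z ^ γ := Real.rpow_nonneg hx.le _
  have key : ∀ (v : ℂ) (M : ℝ), ‖v‖ ≤ 1 → ‖fieldDeriv (fun _ => v) f z‖ ≤ M →
      bdf z * ‖fieldDeriv (fun _ => v) (fun w => (1 - cutoff n w) * f w) z‖ ^ 2 ≤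
        2 * M ^ 2 * w ^ 2 + 8 * M0 ^ 2 * C ^ 2 * T := by
    intro v M hv hM
    have h1 := bdf_mul_norm_sq_fieldDeriv_cutoff_le hC hv n hz
    rw [fieldDeriv_one_sub_cutoff_mul _ hf n hz]
    have h2 := norm_sub_sq_le ((1 - cutoff n z) * fieldDeriv (fun _ => v) f z)
      (f z * fieldDeriv (fun _ => v) (cutoff n) z)
    rw [norm_mul, norm_mul, mul_pow, mul_pow, ← hw] at h2
    have h3 : bdf z * (w ^ 2 * ‖fieldDeriv (fun _ => v) f z‖ ^ 2) ≤ 1 * (w ^ 2 * M ^ 2) := by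
      gcongr
      exact bdf_le_one z
    have h4 : ‖f z‖ ^ 2 * (bdf z * ‖fieldDeriv (fun _ => v) (cutoff n) z‖ ^ 2) ≤
        M0 ^ 2 * (4 * C ^ 2 * (((n : ℝ) + 1)⁻¹) ^ 2 * truncInv ((n : ℝ) + 1) z) := by
      gcongr
      exact hM0 z hz
    have h5 := mul_le_mul_of_nonneg_left h2 hx.le
    rw [hT]
    linarith
  have k1 := key 1 M1 (by simp) (hM1 z hz)
  have k2 := key Complex.I M2 (by simp) (hM2 z hz)
  have k3 : ‖fieldDeriv rot (fun w => (1 - cutoff n w) * f w) z‖ ^ 2 ≤ w ^ 2 * M3 ^ 2 := by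
    rw [fieldDeriv_one_sub_cutoff_mul _ hf n hz, fieldDeriv_rot_cutoff n hz, mul_zero, sub_zero,
      norm_mul, mul_pow]
    gcongr
    exact hM3 z hz
  have k4 : ‖(1 - cutoff n z) * f z‖ ^ 2 ≤ w ^ 2 * M0 ^ 2 := by
    rw [norm_mul, mul_pow]
    gcongr
    exact hM0 z hz
  rw [normEnergy, Real.rpow_add hx, Real.rpow_one]
  set A := ‖fieldDeriv (fun _ => 1) (fun w => (1 - cutoff n w) * f w) z‖ ^ 2
  set B := ‖fieldDeriv (fun _ => Complex.I) (fun w => (1 - cutoff n w) * f w) z‖ ^ 2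
  set R := ‖fieldDeriv rot (fun w => (1 - cutoff n w) * f w) z‖ ^ 2
  set S := ‖(1 - cutoff n z) * f z‖ ^ 2
  have h6 : bdf z ^ γ * (bdf z * A + bdf z * B + R + (γ + 1) ^ 2 * S) ≤
      1 * (bdf z * A + bdf z * B + R + (γ + 1) ^ 2 * S) := by
    gcongr
  have h7 : (γ + 1) ^ 2 * S ≤ (γ + 1) ^ 2 * (w ^ 2 * M0 ^ 2) := by gcongr
  rw [mul_assoc (16 * M0 ^ 2 * C ^ 2), ← hT]
  linarith

theorem integrableOn_normEnergy {γ : ℝ} (hγ : 0 ≤ γ) {f : ℂ → ℂ} (hf : ContDiff ℝ ∞ f) :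
    IntegrableOn (normEnergy γ f) disk := by
  obtain ⟨M, hM⟩ := exists_bound_energy hγ hf (contDiff_conj_comp hf)
  have h : IntegrableOn (energy γ f fun w => starRingEnd ℂ (f w)) disk :=
    integrableOn_of_bounded ((energy_contDiffOn γ hf.contDiffOn
      (contDiff_conj_comp hf).contDiffOn).continuousOn.aestronglyMeasurable
        isOpen_disk.measurableSet) hM
  have h' := Integrable.re h
  simp only [energy_conj_self, RCLike.re_eq_complex_re, Complex.ofReal_re] at h'
  exact h'

/-- With `N = n + 1`, the gradient part of the bound integrates to `K' N^{-2} · 2πN = 2πK' / N`, and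
the rest tends to zero by dominated convergence. -/
theorem tendsto_integral_normEnergy_one_sub_cutoff_mul {γ : ℝ} (hγ : 0 ≤ γ) {f : ℂ → ℂ}
    (hf : ContDiff ℝ ∞ f) :
    Tendsto (fun n => ∫ z in disk, normEnergy γ (fun w => (1 - cutoff n w) * f w) z) atTop
      (𝓝 0) := by
  obtain ⟨K, K', hK⟩ := exists_normEnergy_one_sub_cutoff_mul_le hγ hf
  have hms := isOpen_disk.measurableSet
  have hlim : Tendsto (fun n : ℕ => K * (∫ z in disk, ‖1 - cutoff n z‖ ^ 2) +
      K' * (2 * Real.pi) * (1 / ((n : ℝ) + 1))) atTop (𝓝 (K * 0 + K' * (2 * Real.pi) * 0)) :=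
    (tendsto_integral_one_sub_cutoff.const_mul K).add
      (tendsto_one_div_add_atTop_nhds_zero_nat.const_mul _)
  rw [mul_zero, mul_zero, add_zero] at hlim
  refine squeeze_zero (fun n => setIntegral_nonneg hms fun z hz => normEnergy_nonneg γ _ hz)
    (fun n => ?_) hlim
  have i1 : IntegrableOn (fun z => K * ‖1 - cutoff n z‖ ^ 2) disk := by
    have i0 : IntegrableOn (fun z => ‖1 - cutoff n z‖ ^ 2) disk := by
      refine integrableOn_of_bounded (M := 1) ?_ fun z hz => ?_
      · exact ((continuous_const.sub
          (cutoff_mem_testFunctions n).1.continuous).norm.pow 2).aestronglyMeasurable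
      · rw [Real.norm_of_nonneg (by positivity)]
        exact pow_le_one₀ (norm_nonneg _) (norm_one_sub_cutoff_le_one n hz)
    exact Integrable.const_mul i0 K
  have i2 : IntegrableOn (fun z => K' * (((n : ℝ) + 1)⁻¹) ^ 2 * truncInv ((n : ℝ) + 1) z) disk :=
    (integrableOn_truncInv _).const_mul _
  have hsmooth : ContDiff ℝ ∞ fun w => (1 - cutoff n w) * f w :=
    (contDiff_const.sub (cutoff_mem_testFunctions n).1).mul hf
  have hn : (0 : ℝ) < (n : ℝ) + 1 := by positivity
  refine (setIntegral_mono_on (integrableOn_normEnergy hγ hsmooth) (i1.add i2) hms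
    (hK n)).trans (le_of_eq ?_)
  refine (integral_add i1 i2).trans ?_
  rw [integral_const_mul, integral_const_mul, integral_truncInv hn]
  field_simp

theorem tendsto_eLpNorm_one_sub_cutoff_mul {γ : ℝ} (hγ : 0 ≤ γ) {f : ℂ → ℂ} (hf : ContDiff ℝ ∞ f) :
    Tendsto (fun n => eLpNorm (fun w => (1 - cutoff n w) * f w) 2 (diskMeasure γ)) atTop
      (𝓝 0) := by
  have := isFiniteMeasure_diskMeasure hγ
  obtain ⟨M, hM0, hM⟩ := exists_bound_on_disk hf.continuous
  simp only [eLpNorm_two_sq]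
  have h : Tendsto (fun n => ∫⁻ z, ‖(1 - cutoff n z) * f z‖ₑ ^ 2 ∂(diskMeasure γ)) atTop
      (𝓝 (∫⁻ _, 0 ∂(diskMeasure γ))) := by
    refine tendsto_lintegral_of_dominated_convergence (fun _ => ENNReal.ofReal M ^ 2) (fun n => ?_)
      (fun n => ?_) ?_ ?_
    · exact (((continuous_const.sub (cutoff_mem_testFunctions n).1.continuous).mul
        hf.continuous).enorm.measurable.pow_const 2)
    · filter_upwards [ae_mem_disk γ] with z hz
      gcongr
      rw [← ofReal_norm]
      refine ENNReal.ofReal_le_ofReal ?_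
      rw [norm_mul, ← one_mul M]
      exact mul_le_mul (norm_one_sub_cutoff_le_one n hz) (hM z hz) (norm_nonneg _) zero_le_one
    · rw [lintegral_const]
      exact ENNReal.mul_ne_top (by simp) (measure_ne_top _ _)
    · filter_upwards [ae_mem_disk γ] with z hz
      refine tendsto_const_nhds.congr' ?_
      filter_upwards [eventually_cutoff_eq_one hz] with n hn
      simp [hn]
  rw [lintegral_zero] at h
  simpa using h.ennrpow_const (1 / 2 : ℝ)

/-- For `γ ≥ 0` the space `C^∞(𝔻)` has all the properties of a core. -/
theorem isFriedrichsCore_smoothClosed {γ : ℝ} (hγ : 0 ≤ γ) : IsFriedrichsCore γ smoothClosed := by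
  have htest : testFunctions ≤ smoothClosed := fun t ht => ⟨t, ht.1, fun _ _ => rfl⟩
  refine ⟨fun f hf => memLp_smoothClosed hγ hf, htest, ?_, ?_, ?_, ?_, ?_⟩
  · intro f hf g hg
    rw [integral_conj_mul_keldyshOp hγ hg hf]
    -- Conjugating the energy identity for the pair in the other order gives the same energy
    -- integral, by `conj_energy`.
    have h := congrArg (starRingEnd ℂ) (integral_conj_mul_keldyshOp hγ hf hg)
    rw [← integral_conj, ← integral_conj] at h
    simp only [conj_energy, map_mul, Complex.conj_conj] at h
    rw [← h]
    exact integral_congr_ae (Eventually.of_forall fun z => mul_comm _ _)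
  · intro f hf
    rw [re_integral_conj_mul_keldyshOp hγ hf]
    exact setIntegral_nonneg isOpen_disk.measurableSet fun z hz => normEnergy_nonneg γ _ hz
  · intro h hh ε hε
    obtain ⟨p, hp, hlt⟩ := exists_polynomial_eLpNorm_lt hγ hh hε
    exact ⟨p, polynomials_le_smoothClosed hp, hlt⟩
  · intro h hh ε hε
    obtain ⟨p, hp, hlt⟩ := exists_polynomial_eLpNorm_lt hγ hh hε
    -- Since `L_γ + 1` maps polynomials onto polynomials, density of polynomials is density of the
    -- range.
    obtain ⟨f, hf, hfp⟩ := exists_keldyshOp_add_eq γ hp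
    refine ⟨f, polynomials_le_smoothClosed hf, ?_⟩
    rwa [eLpNorm_congr_ae (g := h - p)]
    filter_upwards [ae_mem_disk γ] with z hz
    simp only [Pi.sub_apply, Pi.add_apply, hfp z hz]
  · intro f hf ε hε
    obtain ⟨f', hf', hff'⟩ := hf
    have ht : ∀ n, (fun w => f' w * cutoff n w) ∈ testFunctions := fun n =>
      mul_mem_testFunctions hf'.contDiffOn (cutoff_mem_testFunctions n)
    have e : ∀ n, EqOn (f - fun w => f' w * cutoff n w) (fun w => (1 - cutoff n w) * f' w) disk :=
      fun n z hz => by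
        simp only [Pi.sub_apply, hff' (Metric.ball_subset_closedBall hz)]
        ring
    obtain ⟨n, h1, h2⟩ := (((tendsto_eLpNorm_one_sub_cutoff_mul hγ hf').eventually_lt_const
      (ENNReal.ofReal_pos.2 hε)).and
      ((tendsto_integral_normEnergy_one_sub_cutoff_mul hγ hf').eventually_lt_const hε)).exists
    refine ⟨_, ht n, ?_, ?_⟩
    · rwa [eLpNorm_congr_ae (g := fun w => (1 - cutoff n w) * f' w)]
      filter_upwards [ae_mem_disk γ] with z hz using e n hz
    · rw [re_integral_conj_mul_keldyshOp hγ (sub_mem ⟨f', hf', hff'⟩ (htest (ht n)))]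
      rwa [setIntegral_congr_fun (g := normEnergy γ fun w => (1 - cutoff n w) * f' w)
        isOpen_disk.measurableSet]
      intro z hz
      simp only [normEnergy, fieldDeriv_congr (e n) hz, e n hz]

end KeldyshDisk

open KeldyshDisk in
theorem lemma2p1 (γ : ℝ) :
    (γ < 0 →
      (∀ f ∈ weightedSmooth (-γ),
        MemLp f 2 (diskMeasure γ) ∧ MemLp (keldyshOp γ f) 2 (diskMeasure γ)) ∧
      IsEssentiallySelfAdjoint (realization γ (weightedSmooth (-γ)) (weightedSmooth_le (-γ))) ∧
      IsFriedrichsExtension (realization γ testFunctions testFunctions_le)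
        (realization γ (weightedSmooth (-γ)) (weightedSmooth_le (-γ))).closure) ∧
    (0 ≤ γ →
      (∀ f ∈ smoothClosed,
        MemLp f 2 (diskMeasure γ) ∧ MemLp (keldyshOp γ f) 2 (diskMeasure γ)) ∧
      IsEssentiallySelfAdjoint (realization γ smoothClosed smoothClosed_le) ∧
      IsFriedrichsExtension (realization γ testFunctions testFunctions_le)
        (realization γ smoothClosed smoothClosed_le).closure) :=
  ⟨fun h => (isFriedrichsCore_smoothClosed (by linarith)).weightedSmooth.isEssentiallySelfAdjoint_and_isFriedrichsExtension _,
    fun h => (isFriedrichsCore_smoothClosed h).isEssentiallySelfAdjoint_and_isFriedrichsExtension _⟩
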